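/- **Setting.** Fix $N\ge 1$ qubits, $T$ time steps, distinct non-identity Pauli strings $P_1,\dots,P_k$ (incoherent generators) with rates $\gamma_\beta(t)\in[0,1]$, and arbitrary Pauli strings $Q_1,\dots,Q_{k_c}$ (coherent generators) with angles $\theta_\alpha(t)\in\mathbb R$, $1\le t\le T$. Let $K=K_{ic}=kT$ be the number of incoherent signals and $$A=\prod_{\alpha,t}\cos^2\theta_\alpha(t)\prod_{\beta,t}(1-\gamma_\beta(t)).$$ A circuit consists of independent, uniformly random $N$-qubit Clifford unitaries $C_1,\dots,C_T$. Starting from $|0\rangle^{\otimes N}$, for $t=1,\dots,T$ one applies $C_t$, then $e^{-i\sum_\alpha\theta_\alpha(t)Q_\alpha}$, then all the channels $\rho\mapsto(1-\gamma_\beta(t))\rho+\gamma_\beta(t)P_\beta\rho P_\beta$; finally one applies $(C_T\cdots C_1)^\dagger$ and measures in the $z$-basis. Let $p(z)$ be the probability of the bitstring $z$, and let $p_0(z)=|\langle z|0\rangle|^2$ and $k_{\beta,t}(z)=|\langle z|C_1^\dagger\cdots C_t^\dagger P_\beta C_t\cdots C_1|0\rangle|^2$. Draw $n_c$ independent circuits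 and measure each of them $m$ times, so that $M=n_cm$ samples are taken in total. Let $V$ be the matrix with rows indexed by (circuit, bitstring) and with columns $V_{\cdot,0}=p_0$, $V_{\cdot,\beta t}=k_{\beta,t}$. Let $\hat N$ be the vector of counts and $$v=(V^TV)^{-1}V^T\frac{\hat N}{M/n_c},\qquad \hat\gamma_\beta(t)=\frac{v_{\beta t}}{v_{\beta t}+v_0}.$$ Let $\bar v=(V^TV)^{-1}V^Tp$ be the mean of $v$ over the measurement outcomes (for given circuits), and let $$b_\beta(t)=\Big|\frac{\bar v_{\beta t}}{\bar v_{\beta t}+\bar v_0}-\gamma_\beta(t)\Big|$$ be the bias of the estimator. Say that the bias is *small at* $(\beta,t)$ if $|\bar v_0-A|\le A/4$ and $\big|\bar v_{\beta t}-A\tfrac{\gamma_\beta(t)}{1-\gamma_\beta(t)}\big|\le A/4$. (If $\bar v_0=A$ and $\bar v_{\beta t}=A\gamma_\beta(t)/(1-\gamma_\beta(t))$ exactly, then the bias is small at $(\beta,t)$ and $b_\beta(t)=0$.) **Theorem.** For every $a>0$ there are constants $C_1,C_2>0$, depending only on $a$, such that the following holds for all data as above with $A\ge a$ and $2K\le 2^N$,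 all $0<\epsilon\le 1$ and all $0<\delta<1$ with $K/\delta\ge 2$. Put $$f=\max\Big\{\frac{\log(K/\delta)}{\epsilon^2},\ \frac{\log(K/\delta)}{\epsilon},\ \frac{\log(K^2/\delta)\log(1/\delta)}{N}\Big\}.$$ 1. If $n_c\ge C_1\,\dfrac{\log(K^2/\delta)}{\log(2^N/K)}$ and $M=n_cm\ge C_1f$, then with probability at least $1-\delta$ over the circuits and the measurement outcomes, $V^TV$ is invertible and, for all $(\beta,t)$ at which the bias is small, $$|\hat\gamma_\beta(t)-\gamma_\beta(t)|\le\epsilon+b_\beta(t).$$ In particular, when bias is neglected, $\max_{\beta,t}|\hat\gamma_\beta(t)-\gamma_\beta(t)|\le\epsilon$. 2. There are $n_c,m$ that satisfy the two conditions in 1 and have $n_cm\le C_2f$; that is, $M=O(f)$ samples suffice. 3. If $2\epsilon^2\log(1/\delta)\le N$, so in particular for all small enough $\epsilon$, the first term dominates: $f=\log(K/\delta)/\epsilon^2$. -/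

import Mathlib

open scoped Matrix

noncomputable section

namespace CliffordSensing

/-- Computational basis labels of `N` qubits. -/
abbrev Bitstring (N : ℕ) := Fin N → Fin 2

/-- Operators on `N` qubits, written in the computational basis. -/
abbrev Op (N : ℕ) := Matrix (Bitstring N) (Bitstring N) ℂ

/-- Labels of `N`-qubit Pauli strings; `0, 1, 2, 3` stand for `𝟙, X, Y, Z`. -/
abbrev PauliString (N : ℕ) := Fin N → Fin 4

/-- The one-qubit matrices `𝟙, X, Y, Z`. -/
def pauli1 : Fin 4 → Matrix (Fin 2) (Fin 2) ℂ :=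
  ![!![1, 0; 0, 1], !![0, 1; 1, 0], !![0, -Complex.I; Complex.I, 0], !![1, 0; 0, -1]]

/-- The tensor product of one-qubit Pauli matrices (no global phase). -/
def pauliOp {N : ℕ} (P : PauliString N) : Op N :=
  Matrix.of fun x y => ∏ i, pauli1 (P i) (x i) (y i)

/-- `U` conjugates every Pauli string to a Pauli string up to sign. -/
def MapsPaulis {N : ℕ} (U : Op N) : Prop :=
  ∀ P : PauliString N, ∃ Q : PauliString N,
    U * pauliOp P * Uᴴ = pauliOp Q ∨ U * pauliOp P * Uᴴ = -pauliOp Q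

theorem MapsPaulis.mul {N : ℕ} {U V : Op N} (hU : MapsPaulis U) (hV : MapsPaulis V) :
    MapsPaulis (U * V) := by
  intro P
  have key : U * V * pauliOp P * (U * V)ᴴ = U * (V * pauliOp P * Vᴴ) * Uᴴ := by
    rw [Matrix.conjTranspose_mul]; simp only [Matrix.mul_assoc]
  obtain ⟨Q, hQ⟩ := hV P
  obtain ⟨R, hR⟩ := hU Q
  refine ⟨R, ?_⟩
  rw [key]
  rcases hQ with hQ | hQ <;> rcases hR with hR | hR <;> rw [hQ] <;>
    simp [hR]

/-- The `N`-qubit Clifford group: the unitaries that normalize the Pauli group. -/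
def cliffordGroup (N : ℕ) : Subgroup (Matrix.unitaryGroup (Bitstring N) ℂ) where
  carrier := {U | MapsPaulis (U : Op N) ∧ MapsPaulis (U : Op N)ᴴ}
  one_mem' := by
    constructor <;> intro P <;> exact ⟨P, Or.inl (by simp)⟩
  mul_mem' := by
    rintro U V ⟨hU, hU'⟩ ⟨hV, hV'⟩
    refine ⟨hU.mul hV, ?_⟩
    have : ((U * V : Matrix.unitaryGroup (Bitstring N) ℂ) : Op N)ᴴ
        = (V : Op N)ᴴ * (U : Op N)ᴴ := by
      simp [Matrix.conjTranspose_mul]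
    rw [this]
    exact hV'.mul hU'
  inv_mem' := by
    rintro U ⟨hU, hU'⟩
    have h : ((U⁻¹ : Matrix.unitaryGroup (Bitstring N) ℂ) : Op N) = (U : Op N)ᴴ := rfl
    constructor
    · rw [h]; exact hU'
    · rw [h, Matrix.conjTranspose_conjTranspose]; exact hU

/-- The Clifford unitaries that are a global phase times the identity. -/
def globalPhases (N : ℕ) : Subgroup (cliffordGroup N) where
  carrier := {U | ∃ c : ℂ, (((U : Matrix.unitaryGroup (Bitstring N) ℂ)) : Op N) = c • 1}
  one_mem' := ⟨1, by simp⟩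
  mul_mem' := by
    rintro U V ⟨c, hc⟩ ⟨d, hd⟩
    exact ⟨c * d, by simp [hc, hd, smul_smul, mul_comm]⟩
  inv_mem' := by
    rintro U ⟨c, hc⟩
    refine ⟨star c, ?_⟩
    have h : (((U⁻¹ : cliffordGroup N) : Matrix.unitaryGroup (Bitstring N) ℂ) : Op N)
        = (((U : Matrix.unitaryGroup (Bitstring N) ℂ)) : Op N)ᴴ := rfl
    rw [h, hc]
    simp [Matrix.conjTranspose_smul]

/-- The Clifford group modulo global phases, a finite set on which "uniformly random" refers to
the counting measure. -/
abbrev Clifford (N : ℕ) := cliffordGroup N ⧸ globalPhases N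

theorem pauliOp_update_z {N : ℕ} (i : Fin N) :
    pauliOp (Function.update (0 : PauliString N) i 3)
      = Matrix.diagonal fun x : Bitstring N => if x i = 0 then (1 : ℂ) else -1 := by
  ext x y
  have h0 : ∀ a b : Fin 2, pauli1 0 a b = if a = b then 1 else 0 := by
    intro a b; fin_cases a <;> fin_cases b <;> simp [pauli1]
  have h3 : ∀ a b : Fin 2,
      pauli1 3 a b = if a = b then (if a = 0 then 1 else -1) else 0 := by
    intro a b; fin_cases a <;> fin_cases b <;> simp [pauli1]
  simp only [pauliOp, Matrix.of_apply, Matrix.diagonal_apply]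
  by_cases hxy : x = y
  · subst hxy
    rw [if_pos rfl, Finset.prod_eq_single i]
    · simp [h3]
    · intro j _ hj; simp [Function.update_of_ne hj, h0]
    · simp
  · rw [if_neg hxy]
    obtain ⟨j, hj⟩ := Function.ne_iff.mp hxy
    apply Finset.prod_eq_zero (Finset.mem_univ j)
    by_cases hji : j = i
    · subst hji; simp [h3, hj]
    · simp [Function.update_of_ne hji, h0, hj]

theorem scalar_of_commutes {N : ℕ} (W : Op N)
    (hW : ∀ P : PauliString N, W * pauliOp P = pauliOp P * W) : ∃ c : ℂ, W = c • 1 := by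
  have hoff : ∀ x y, x ≠ y → W x y = 0 := by
    intro x y hxy
    obtain ⟨i, hi⟩ := Function.ne_iff.mp hxy
    have h := congrFun (congrFun (hW (Function.update 0 i 3)) x) y
    rw [pauliOp_update_z, Matrix.mul_diagonal, Matrix.diagonal_mul] at h
    by_cases hx : x i = 0
    · have hy : ¬ y i = 0 := fun h' => hi (hx.trans h'.symm)
      rw [if_pos hx, if_neg hy] at h
      linear_combination (-1 / 2 : ℂ) * h
    · have hy : y i = 0 := by omega
      rw [if_neg hx, if_pos hy] at h
      linear_combination (1 / 2 : ℂ) * h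
  have hd : W = Matrix.diagonal fun x => W x x := by
    ext x y
    by_cases hxy : x = y
    · subst hxy; simp
    · rw [hoff x y hxy, Matrix.diagonal_apply_ne _ hxy]
  have hc : ∀ x y, W x x = W y y := by
    intro x y
    have h := congrFun (congrFun (hW fun i => if x i = y i then 0 else 1) x) y
    rw [hd, Matrix.mul_diagonal, Matrix.diagonal_mul] at h
    have h1 : pauliOp (fun i => if x i = y i then (0 : Fin 4) else 1) x y = 1 := by
      simp only [pauliOp, Matrix.of_apply]
      apply Finset.prod_eq_one
      intro i _
      generalize x i = a
      generalize y i = b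
      fin_cases a <;> fin_cases b <;> simp [pauli1]
    rw [h1] at h
    simpa using h
  refine ⟨W 0 0, ?_⟩
  rw [hd]
  ext x y
  by_cases hxy : x = y
  · subst hxy; simpa using hc x 0
  · simp [hxy]

instance (N : ℕ) : Finite (Clifford N) := by
  let S : Set (Op N) := Set.range pauliOp ∪ Set.range fun P : PauliString N => -pauliOp P
  have hS : S.Finite := (Set.finite_range _).union (Set.finite_range _)
  let f : cliffordGroup N → PauliString N → Op N := fun U P =>
    ((U : Matrix.unitaryGroup (Bitstring N) ℂ) : Op N) * pauliOp P *
      ((U : Matrix.unitaryGroup (Bitstring N) ℂ) : Op N)ᴴ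
  have hf : (Set.range f).Finite := by
    refine (Set.Finite.pi (fun _ : PauliString N => hS)).subset ?_
    rintro _ ⟨U, rfl⟩ P -
    obtain ⟨Q, hQ | hQ⟩ := U.2.1 P
    · exact Or.inl ⟨Q, hQ.symm⟩
    · exact Or.inr ⟨Q, hQ.symm⟩
  have : Finite (Set.range f) := hf
  refine Finite.of_injective
    (fun C : Clifford N => (⟨f C.out, C.out, rfl⟩ : Set.range f)) ?_
  intro C D hCD
  have h : f C.out = f D.out := congrArg Subtype.val hCD
  rw [← C.out_eq', ← D.out_eq']
  apply QuotientGroup.eq.mpr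
  set u : Op N := ((C.out : Matrix.unitaryGroup (Bitstring N) ℂ) : Op N) with hu
  set v : Op N := ((D.out : Matrix.unitaryGroup (Bitstring N) ℂ) : Op N) with hv
  have huu : uᴴ * u = 1 := Unitary.coe_star_mul_self
    ((C.out : cliffordGroup N) : Matrix.unitaryGroup (Bitstring N) ℂ)
  have hvv : vᴴ * v = 1 := Unitary.coe_star_mul_self
    ((D.out : cliffordGroup N) : Matrix.unitaryGroup (Bitstring N) ℂ)
  change ∃ c : ℂ, uᴴ * v = c • 1
  apply scalar_of_commutes
  intro P
  have hP : u * pauliOp P * uᴴ = v * pauliOp P * vᴴ := congrFun h P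
  calc uᴴ * v * pauliOp P = uᴴ * (v * pauliOp P * vᴴ) * v := by
        simp only [Matrix.mul_assoc, hvv, Matrix.mul_one]
    _ = (uᴴ * u) * pauliOp P * (uᴴ * v) := by
        rw [← hP]; simp only [Matrix.mul_assoc]
    _ = pauliOp P * (uᴴ * v) := by rw [huu, Matrix.one_mul]

instance (N : ℕ) : Fintype (Clifford N) := Fintype.ofFinite _

/-- A unitary representing a Clifford element; nothing below depends on its global phase. -/
def Clifford.toOp {N : ℕ} (C : Clifford N) : Op N :=
  ((C.out : Matrix.unitaryGroup (Bitstring N) ℂ) : Op N)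

/-- Signals accumulated over `T` time steps on `N` qubits: `kc` coherent Pauli generators with
angles `θ α t`, and `k` incoherent Pauli generators with rates `γ β t`. -/
structure Signals (N T kc k : ℕ) where
  cohPauli : Fin kc → PauliString N
  θ : Fin kc → Fin T → ℝ
  incPauli : Fin k → PauliString N
  γ : Fin k → Fin T → ℝ

variable {N T kc k nc m : ℕ}

/-- `A = ∏ cos² θ_α(t) · ∏ (1 - γ_β(t))`. -/
def Signals.fidelity (S : Signals N T kc k) : ℝ :=
  (∏ α, ∏ t, Real.cos (S.θ α t) ^ 2) * ∏ β, ∏ t, (1 - S.γ β t)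

/-- The unitary `exp (-i ∑_α θ_α(t) P_α)`. -/
def Signals.cohOp (S : Signals N T kc k) (t : Fin T) : Op N :=
  NormedSpace.exp (-Complex.I • ∑ α, (S.θ α t : ℂ) • pauliOp (S.cohPauli α))

/-- The Pauli channel `ρ ↦ (1 - g) ρ + g P ρ P`. -/
def pauliChannel (g : ℝ) (P : PauliString N) (ρ : Op N) : Op N :=
  ((1 - g : ℝ) : ℂ) • ρ + (g : ℂ) • (pauliOp P * ρ * pauliOp P)

/-- The signal of time step `t`: the coherent rotation, then all the incoherent Pauli channels
(these commute with each other, so their order is immaterial). -/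
def Signals.layer (S : Signals N T kc k) (t : Fin T) (ρ : Op N) : Op N :=
  (List.finRange k).foldl (fun σ β => pauliChannel (S.γ β t) (S.incPauli β) σ)
    (S.cohOp t * ρ * (S.cohOp t)ᴴ)

/-- The product `C_j ⋯ C_2 C_1` of the first `j` Clifford unitaries of a circuit. -/
def partialCircuit (C : Fin T → Clifford N) (j : ℕ) : Op N :=
  ((List.finRange T).take j).foldl (fun U t => (C t).toOp * U) 1

/-- The final state: start in `|0⟩⟨0|`, alternate Clifford unitaries with signal layers, and undo
the total Clifford unitary. -/
def Signals.finalState (S : Signals N T kc k) (C : Fin T → Clifford N) : Op N :=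
  (partialCircuit C T)ᴴ *
    ((List.finRange T).foldl (fun ρ t => S.layer t ((C t).toOp * ρ * ((C t).toOp)ᴴ))
      (Matrix.single 0 0 1)) *
    partialCircuit C T

/-- The probability of the outcome `z` of a `z`-basis measurement of the final state. -/
def Signals.outcomeProb (S : Signals N T kc k) (C : Fin T → Clifford N) (z : Bitstring N) : ℝ :=
  (S.finalState C z z).re

/-- `k_{β,t}(z) = |⟨z| C_1† ⋯ C_t† P_β C_t ⋯ C_1 |0⟩|²`. -/
def Signals.pattern (S : Signals N T kc k) (C : Fin T → Clifford N) (β : Fin k) (t : Fin T)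
    (z : Bitstring N) : ℝ :=
  ‖((partialCircuit C (t + 1))ᴴ * pauliOp (S.incPauli β) * partialCircuit C (t + 1)) z 0‖ ^ 2

/-- The regression matrix `V` of `nc` circuits: its rows are pairs (circuit, bitstring), the column
`none` is the signal-free distribution `p₀(z) = |⟨0|z⟩|²` and the column `some (β, t)` is
`k_{β,t}`. -/
def Signals.design (S : Signals N T kc k) (C : Fin nc → Fin T → Clifford N) :
    Matrix (Fin nc × Bitstring N) (Option (Fin k × Fin T)) ℝ :=
  Matrix.of fun r c =>
    match c with
    | none => if r.2 = 0 then 1 else 0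
    | some s => S.pattern (C r.1) s.1 s.2 r.2

/-- The least-squares coefficients `(VᵀV)⁻¹ Vᵀ f` of a vector `f` of frequencies. -/
def Signals.coeff (S : Signals N T kc k) (C : Fin nc → Fin T → Clifford N)
    (f : Fin nc × Bitstring N → ℝ) : Option (Fin k × Fin T) → ℝ :=
  (((S.design C)ᵀ * S.design C)⁻¹ * (S.design C)ᵀ) *ᵥ f

/-- The value `v_{βt} / (v_{βt} + v_0)` computed from a vector `f` of frequencies. -/
def Signals.rate (S : Signals N T kc k) (C : Fin nc → Fin T → Clifford N)
    (f : Fin nc × Bitstring N → ℝ) (β : Fin k) (t : Fin T) : ℝ :=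
  S.coeff C f (some (β, t)) / (S.coeff C f (some (β, t)) + S.coeff C f none)

/-- The empirical frequencies of `m` shots on each of the `nc` circuits. -/
def empirical (z : Fin nc → Fin m → Bitstring N) (r : Fin nc × Bitstring N) : ℝ :=
  ((Finset.univ.filter fun j => z r.1 j = r.2).card : ℝ) / m

/-- The exact outcome probabilities of the `nc` circuits, the mean of the empirical frequencies. -/
def Signals.exact (S : Signals N T kc k) (C : Fin nc → Fin T → Clifford N)
    (r : Fin nc × Bitstring N) : ℝ :=
  S.outcomeProb (C r.1) r.2

/-- The estimator `γ̂_β(t)`. -/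
def Signals.estimator (S : Signals N T kc k) (C : Fin nc → Fin T → Clifford N)
    (z : Fin nc → Fin m → Bitstring N) (β : Fin k) (t : Fin T) : ℝ :=
  S.rate C (empirical z) β t

/-- The bias of the estimator: the error that remains without statistical fluctuations, when the
least-squares coefficients take their mean values. -/
def Signals.bias (S : Signals N T kc k) (C : Fin nc → Fin T → Clifford N)
    (β : Fin k) (t : Fin T) : ℝ :=
  |S.rate C (S.exact C) β t - S.γ β t|

/-- The mean values of the least-squares coefficients `v_0` and `v_{βt}` are within `A / 4` of their
ideal values `A` and `A γ_β(t) / (1 - γ_β(t))`. -/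
def Signals.SmallBias (S : Signals N T kc k) (C : Fin nc → Fin T → Clifford N)
    (β : Fin k) (t : Fin T) : Prop :=
  |S.coeff C (S.exact C) none - S.fidelity| ≤ S.fidelity / 4 ∧
  |S.coeff C (S.exact C) (some (β, t)) - S.fidelity * (S.γ β t / (1 - S.γ β t))|
    ≤ S.fidelity / 4

open Classical in
/-- The probability of an event about the circuits and the measured bitstrings, when `nc` circuits
of `T` independent uniformly random Clifford elements are drawn and each of them is measured `m`
times independently. -/
def Signals.prob (S : Signals N T kc k)
    (E : (Fin nc → Fin T → Clifford N) → (Fin nc → Fin m → Bitstring N) → Prop) : ℝ :=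
  (∑ C : Fin nc → Fin T → Clifford N, ∑ z : Fin nc → Fin m → Bitstring N,
      if E C z then ∏ n, ∏ j, S.outcomeProb (C n) (z n j) else 0) /
    Fintype.card (Fin nc → Fin T → Clifford N)

/-- `max {log (K/δ) / ε², log (K/δ) / ε, log (K²/δ) log (1/δ) / N}`. -/
def sampleBound (N K : ℕ) (ε δ : ℝ) : ℝ :=
  max (Real.log (K / δ) / ε ^ 2)
    (max (Real.log (K / δ) / ε) (Real.log (K ^ 2 / δ) * Real.log (1 / δ) / N))

/-- `log (K²/δ) / log (2^N / K)`. -/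
def circuitBound (N K : ℕ) (δ : ℝ) : ℝ :=
  Real.log (K ^ 2 / δ) / Real.log (2 ^ N / K)

end CliffordSensing

end

open scoped Matrix

namespace CliffordSensing

/-! A Clifford unitary conjugates a Pauli string to a signed Pauli string, and a Pauli string sends
$|0\rangle$ to a basis state up to phase. So in each circuit every column of $V$ is the indicator of
a single bitstring (`Signals.design_apply`), and the conditioning of $V^TV$ becomes a question about
collisions of random bitstrings.

The Clifford group is transitive on non-identity Pauli strings, so a random element spreads such a
string uniformly over $4^N-1$ targets, only $2^N$ of which have a given flip pattern. Hence two
columns collide in a circuit with probability at most $2^N/(4^N-1)$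
(`Signals.card_collision_mul_le`). By a union bound a column fails to be isolated with probability
at most $\tfrac43K/2^N$. A Chernoff bound over the independent circuits then makes every column
isolated in at least $n_c/16$ of them, except with probability $\delta/2$
(`Signals.card_exists_isolatedCount_lt_le`).

Isolation gives $u^TV^TVu\ge(n_c/16)u_a^2$ for every coordinate $a$. This yields invertibility, and
also $(V^TV)^{-1}_{aa}\le16/n_c$, which is the squared length of row $a$ of the pseudo-inverse
(`Signals.sum_sq_pinv_le`). Thus $v_a-\bar v_a$ is a linear functional, with small $\ell^2$ norm, of
the fluctuations of independent shots. It exceeds $\eta$ with probability at most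
$2e^{-M\eta^2/256}$ (`prob_lt_abs_sum_le`). The noise model enters only through the fact that the
outcome probabilities form a distribution; the systematic error stays in the bias.

Where the bias is small, the denominator $\bar v_{\beta t}+\bar v_0$ is at least $A/2$, so the ratio
is stable (`abs_ratio_sub_le`) and $\eta\sim a^2\epsilon$ suffices. -/

/-! ### Algebra of Pauli strings. -/

/-- The tensor product of one-qubit matrices. -/
def tensor {N : ℕ} (f : Fin N → Matrix (Fin 2) (Fin 2) ℂ) : Op N :=
  Matrix.of fun x y => ∏ i, f i (x i) (y i)

theorem pauliOp_eq_tensor {N : ℕ} (P : PauliString N) :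
    pauliOp P = tensor fun i => pauli1 (P i) := rfl

theorem tensor_mul {N : ℕ} (f g : Fin N → Matrix (Fin 2) (Fin 2) ℂ) :
    tensor f * tensor g = tensor fun i => f i * g i := by
  ext x y
  simp only [tensor, Matrix.mul_apply, Matrix.of_apply, ← Finset.prod_mul_distrib]
  rw [Finset.prod_univ_sum, Fintype.piFinset_univ]

theorem trace_tensor {N : ℕ} (f : Fin N → Matrix (Fin 2) (Fin 2) ℂ) :
    (tensor f).trace = ∏ i, (f i).trace := by
  simp only [tensor, Matrix.trace, Matrix.diag, Matrix.of_apply]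
  rw [Finset.prod_univ_sum, Fintype.piFinset_univ]

theorem tensor_smul {N : ℕ} (c : Fin N → ℂ) (f : Fin N → Matrix (Fin 2) (Fin 2) ℂ) :
    (tensor fun i => c i • f i) = (∏ i, c i) • tensor f := by
  ext x y
  simp [tensor, Finset.prod_mul_distrib]

theorem conjTranspose_tensor {N : ℕ} (f : Fin N → Matrix (Fin 2) (Fin 2) ℂ) :
    (tensor f)ᴴ = tensor fun i => (f i)ᴴ := by
  ext x y
  simp [tensor, Matrix.conjTranspose_apply]

/-- The label of the product of two one-qubit Pauli matrices. -/
def mul1 (a b : Fin 4) : Fin 4 := a ^^^ b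

/-- The commutation sign of two one-qubit Pauli matrices. -/
def sign1 (a b : Fin 4) : ℂ := if a = 0 ∨ b = 0 ∨ a = b then 1 else -1

/-- Bitwise xor gives the right label because the product of two distinct matrices among $X,Y,Z$,
numbered 1, 2, 3, is the third up to phase. Of the phase only $c^4=1$ is needed. -/
theorem pauli1_mul (a b : Fin 4) :
    ∃ c : ℂ, c ^ 4 = 1 ∧ pauli1 a * pauli1 b = c • pauli1 (mul1 a b) := by
  have hI : Complex.I ^ 4 = 1 := Complex.I_pow_four
  have hI' : (-Complex.I) ^ 4 = 1 := by rw [neg_pow, hI]; norm_num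
  fin_cases a <;> fin_cases b <;>
    first
    | (refine ⟨1, by norm_num, ?_⟩
       ext i j
       fin_cases i <;> fin_cases j <;>
         simp [pauli1, mul1, Matrix.mul_apply, Fin.sum_univ_two]
       done)
    | (refine ⟨Complex.I, hI, ?_⟩
       ext i j
       fin_cases i <;> fin_cases j <;>
         simp [pauli1, mul1, Matrix.mul_apply, Fin.sum_univ_two]
       done)
    | (refine ⟨-Complex.I, hI', ?_⟩
       ext i j
       fin_cases i <;> fin_cases j <;>
         simp [pauli1, mul1, Matrix.mul_apply, Fin.sum_univ_two])

theorem pauli1_mul_comm (a b : Fin 4) :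
    pauli1 a * pauli1 b = sign1 a b • (pauli1 b * pauli1 a) := by
  fin_cases a <;> fin_cases b <;> ext i j <;> fin_cases i <;> fin_cases j <;>
    simp [pauli1, sign1, Matrix.mul_apply, Fin.sum_univ_two]

theorem conjTranspose_pauli1 (a : Fin 4) : (pauli1 a)ᴴ = pauli1 a := by
  fin_cases a <;> ext i j <;> fin_cases i <;> fin_cases j <;>
    simp [pauli1, Matrix.conjTranspose_apply]

theorem pauli1_mul_self (a : Fin 4) : pauli1 a * pauli1 a = 1 := by
  fin_cases a <;> ext i j <;> fin_cases i <;> fin_cases j <;>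
    simp [pauli1, Matrix.mul_apply, Fin.sum_univ_two]

theorem trace_pauli1 {a : Fin 4} (ha : a ≠ 0) : (pauli1 a).trace = 0 := by
  fin_cases a <;> simp_all [pauli1, Matrix.trace, Fin.sum_univ_two]

/-- The label of the product of two Pauli strings. -/
def mulLabel {N : ℕ} (P Q : PauliString N) : PauliString N := fun i => mul1 (P i) (Q i)

/-- The bits flipped by a Pauli string. -/
def flips {N : ℕ} (P : PauliString N) : Bitstring N :=
  fun i => if P i = 1 ∨ P i = 2 then 1 else 0

variable {N : ℕ}

theorem mulLabel_eq_zero {P Q : PauliString N} (h : mulLabel P Q = 0) : P = Q := by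
  funext i
  have hi : mul1 (P i) (Q i) = 0 := congrFun h i
  revert hi
  generalize P i = a
  generalize Q i = b
  revert a b
  decide

theorem flips_mulLabel {P Q : PauliString N} :
    flips (mulLabel P Q) = 0 ↔ flips P = flips Q := by
  simp only [funext_iff]
  refine forall_congr' fun i => ?_
  have h : ∀ a b : Fin 4,
      (if mul1 a b = 1 ∨ mul1 a b = 2 then (1 : Fin 2) else 0) = 0 ↔
        (if a = 1 ∨ a = 2 then (1 : Fin 2) else 0) = if b = 1 ∨ b = 2 then 1 else 0 := by
    decide
  exact h (P i) (Q i)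

/-- At each site exactly two of the four letters have the prescribed flip bit. -/
theorem card_flips (z : Bitstring N) :
    (Finset.univ.filter fun P : PauliString N => flips P = z).card = 2 ^ N := by
  have h : (Finset.univ.filter fun P : PauliString N => flips P = z)
      = Fintype.piFinset fun i => Finset.univ.filter fun a : Fin 4 =>
          (if a = 1 ∨ a = 2 then (1 : Fin 2) else 0) = z i := by
    ext P
    simp [flips, funext_iff]
  have h2 : ∀ b : Fin 2, (Finset.univ.filter fun a : Fin 4 =>
      (if a = 1 ∨ a = 2 then (1 : Fin 2) else 0) = b).card = 2 := by decide
  rw [h, Fintype.card_piFinset]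
  simp [h2]

theorem pauliOp_mul (P Q : PauliString N) :
    ∃ c : ℂ, c ^ 4 = 1 ∧ pauliOp P * pauliOp Q = c • pauliOp (mulLabel P Q) := by
  choose c hc h using fun i => pauli1_mul (P i) (Q i)
  refine ⟨∏ i, c i, ?_, ?_⟩
  · rw [← Finset.prod_pow]; exact Finset.prod_eq_one fun i _ => hc i
  · simp only [pauliOp_eq_tensor, tensor_mul, h, tensor_smul]
    rfl

theorem pauliOp_mul_comm (P Q : PauliString N) :
    pauliOp P * pauliOp Q = (∏ i, sign1 (P i) (Q i)) • (pauliOp Q * pauliOp P) := by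
  simp only [pauliOp_eq_tensor, tensor_mul, ← tensor_smul]
  congr 1
  funext i
  exact pauli1_mul_comm _ _

theorem prod_sign1 (P Q : PauliString N) :
    ∏ i, sign1 (P i) (Q i) = 1 ∨ ∏ i, sign1 (P i) (Q i) = -1 := by
  have h : (∏ i, sign1 (P i) (Q i)) ^ 2 = 1 := by
    rw [← Finset.prod_pow]
    refine Finset.prod_eq_one fun i _ => ?_
    unfold sign1
    split_ifs <;> norm_num
  exact sq_eq_one_iff.mp h

theorem conjTranspose_pauliOp (P : PauliString N) : (pauliOp P)ᴴ = pauliOp P := by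
  simp only [pauliOp_eq_tensor, conjTranspose_tensor, conjTranspose_pauli1]

theorem pauliOp_zero : pauliOp (0 : PauliString N) = 1 := by
  ext x y
  have h0 : ∀ a b : Fin 2, pauli1 0 a b = if a = b then 1 else 0 := by
    intro a b; fin_cases a <;> fin_cases b <;> simp [pauli1]
  simp only [pauliOp, Matrix.of_apply, Pi.zero_apply, h0, Matrix.one_apply, funext_iff]
  rw [Finset.prod_ite_zero]
  simp

theorem pauliOp_mul_self (P : PauliString N) : pauliOp P * pauliOp P = 1 := by
  have h1 : (1 : Matrix (Fin 2) (Fin 2) ℂ) = pauli1 0 := by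
    ext a b; fin_cases a <;> fin_cases b <;> simp [pauli1]
  simp only [pauliOp_eq_tensor, tensor_mul, pauli1_mul_self, h1]
  exact pauliOp_zero

theorem trace_pauliOp {P : PauliString N} (hP : P ≠ 0) : (pauliOp P).trace = 0 := by
  obtain ⟨i, hi⟩ := Function.ne_iff.mp hP
  rw [pauliOp_eq_tensor, trace_tensor]
  exact Finset.prod_eq_zero (Finset.mem_univ i) (trace_pauli1 hi)

/-! ### Pauli strings up to sign, and their action on the zero state. -/

/-- Equality of operators up to sign. -/
def EqUpToSign (A B : Op N) : Prop := A = B ∨ A = -B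

theorem EqUpToSign.symm {A B : Op N} (h : EqUpToSign A B) : EqUpToSign B A := by
  rcases h with h | h
  · exact Or.inl h.symm
  · exact Or.inr (by rw [h, neg_neg])

theorem EqUpToSign.trans {A B D : Op N} (h : EqUpToSign A B) (h' : EqUpToSign B D) :
    EqUpToSign A D := by
  unfold EqUpToSign at *
  rcases h with rfl | rfl <;> rcases h' with rfl | rfl <;> simp

theorem EqUpToSign.conj {A B : Op N} (h : EqUpToSign A B) (U V : Op N) :
    EqUpToSign (U * A * V) (U * B * V) := by
  rcases h with rfl | rfl
  · exact Or.inl rfl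
  · exact Or.inr (by simp)

theorem EqUpToSign.mul {A B A' B' : Op N} (h : EqUpToSign A B) (h' : EqUpToSign A' B') :
    EqUpToSign (A * A') (B * B') := by
  unfold EqUpToSign at *
  rcases h with rfl | rfl <;> rcases h' with rfl | rfl <;> simp

/-- Trace orthogonality: for distinct labels $PQ$ is traceless, which forces $c=0$ and contradicts
$P^2=1$. -/
theorem label_eq_of_eq_smul {P Q : PauliString N} {c : ℂ} (h : pauliOp P = c • pauliOp Q) :
    P = Q := by
  by_contra hPQ
  have hne : mulLabel P Q ≠ 0 := fun h0 => hPQ (mulLabel_eq_zero h0)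
  obtain ⟨d, -, hd⟩ := pauliOp_mul P Q
  have ht : (pauliOp P * pauliOp Q).trace = 0 := by
    rw [hd, Matrix.trace_smul, trace_pauliOp hne, smul_zero]
  rw [h, Matrix.smul_mul, pauliOp_mul_self, Matrix.trace_smul, Matrix.trace_one, smul_eq_mul] at ht
  have hc : c = 0 := by simpa using ht
  have h1 := pauliOp_mul_self P
  rw [h, hc, zero_smul, zero_mul] at h1
  exact zero_ne_one h1

theorem EqUpToSign.label_eq {P Q : PauliString N} (h : EqUpToSign (pauliOp P) (pauliOp Q)) :
    P = Q := by
  rcases h with h | h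
  · exact label_eq_of_eq_smul (c := 1) (by rw [h, one_smul])
  · exact label_eq_of_eq_smul (c := -1) (by rw [h, neg_one_smul])

/-- $X$ and $Y$ flip the bit, $\mathbb 1$ and $Z$ do not, so the column at 0 has one nonzero entry,
of modulus one. -/
theorem norm_pauliOp_zero_col (P : PauliString N) (z : Bitstring N) :
    ‖pauliOp P z 0‖ ^ 2 = if z = flips P then 1 else 0 := by
  have h : ∀ (a : Fin 4) (b : Fin 2),
      ‖pauli1 a b 0‖ = if b = (if a = 1 ∨ a = 2 then (1 : Fin 2) else 0) then 1 else 0 := by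
    intro a b
    fin_cases a <;> fin_cases b <;> simp [pauli1]
  simp only [pauliOp, Matrix.of_apply, norm_prod, Pi.zero_apply, h]
  rw [Finset.prod_ite_zero]
  simp [funext_iff, flips]

/-! ### Transitivity of the Clifford group on non-identity Pauli strings. -/

/-- `(P + Q) / √2` for two Pauli strings. -/
noncomputable def halfSum (P Q : PauliString N) : Op N := ((√2 : ℝ)⁻¹ : ℂ) • (pauliOp P + pauliOp Q)

theorem conjTranspose_halfSum (P Q : PauliString N) : (halfSum P Q)ᴴ = halfSum P Q := by
  simp [halfSum, Matrix.conjTranspose_smul, conjTranspose_pauliOp]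

theorem halfSum_conj (P Q : PauliString N) (R : Op N) :
    halfSum P Q * R * halfSum P Q
      = (2⁻¹ : ℂ) • ((pauliOp P + pauliOp Q) * R * (pauliOp P + pauliOp Q)) := by
  have h : ((√2 : ℝ)⁻¹ : ℂ) * ((√2 : ℝ)⁻¹ : ℂ) = 2⁻¹ := by
    rw [← mul_inv, ← Complex.ofReal_mul, Real.mul_self_sqrt (by norm_num)]
    norm_num
  simp only [halfSum, Matrix.smul_mul, Matrix.mul_smul, smul_smul, h]

/-- With commutation signs $s,t=\pm1$ only one of the two terms survives: a multiple of $R$ if the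
signs agree, a multiple of $RPQ$ if they differ. -/
theorem add_conj_of_anticommute {P Q R : Op N} (hP : P * P = 1) (hQ : Q * Q = 1)
    (hPQ : Q * P = -(P * Q)) {s t : ℂ} (hs : P * R = s • (R * P)) (ht : Q * R = t • (R * Q)) :
    (P + Q) * R * (P + Q) = (s + t) • R + (s - t) • (R * P * Q) := by
  have h1 : (P + Q) * R * (P + Q) = s • (R * (P * P)) + s • (R * (P * Q)) + t • (R * (Q * P))
      + t • (R * (Q * Q)) := by
    rw [add_mul, hs, ht]
    simp only [add_mul, mul_add, Matrix.smul_mul, Matrix.mul_assoc]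
    abel
  rw [h1, hP, hQ, hPQ]
  simp only [mul_one, mul_neg, smul_neg, add_smul, sub_smul, Matrix.mul_assoc]
  abel

theorem halfSum_mul_self {P Q : PauliString N}
    (h : pauliOp Q * pauliOp P = -(pauliOp P * pauliOp Q)) : halfSum P Q * halfSum P Q = 1 := by
  have h1 := halfSum_conj P Q 1
  rw [add_conj_of_anticommute (pauliOp_mul_self P) (pauliOp_mul_self Q) h (s := 1) (t := 1)
    (by simp) (by simp)] at h1
  rw [mul_one] at h1
  rw [h1, sub_self, zero_smul, add_zero, smul_smul]
  norm_num

theorem halfSum_conj_left {P Q : PauliString N}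
    (h : pauliOp Q * pauliOp P = -(pauliOp P * pauliOp Q)) :
    halfSum P Q * pauliOp P * halfSum P Q = pauliOp Q := by
  rw [halfSum_conj, add_conj_of_anticommute (pauliOp_mul_self P) (pauliOp_mul_self Q) h
    (s := 1) (t := -1) (by simp) (by rw [h]; simp), pauliOp_mul_self]
  norm_num [smul_smul]

/-- Hermiticity makes $c$ real, and a real fourth root of unity is $\pm1$. -/
theorem smul_pauliOp_of_isHermitian {c : ℂ} (hc : c ^ 4 = 1) (R : PauliString N)
    (h : (c • pauliOp R)ᴴ = c • pauliOp R) : EqUpToSign (c • pauliOp R) (pauliOp R) := by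
  rw [Matrix.conjTranspose_smul, conjTranspose_pauliOp] at h
  have h2 : star c = c := by
    have h3 := congrArg (fun A => (A * pauliOp R) 0 0) h
    simpa [Matrix.smul_mul, pauliOp_mul_self] using h3
  obtain ⟨r, rfl⟩ := Complex.conj_eq_iff_real.mp h2
  have hr : r ^ 4 = 1 := by exact_mod_cast hc
  have hr2 : r ^ 2 = 1 := by nlinarith [sq_nonneg r, sq_nonneg (r ^ 2 - 1)]
  rcases sq_eq_one_iff.mp hr2 with rfl | rfl
  · left; simp
  · right; simp

/-- Equal commutation signs give $\pm R$. Opposite signs give a phase times the string of $RPQ$, and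
since the conjugate is again Hermitian that phase is a sign. -/
theorem mapsPaulis_halfSum {P Q : PauliString N}
    (h : pauliOp Q * pauliOp P = -(pauliOp P * pauliOp Q)) : MapsPaulis (halfSum P Q) := by
  intro R
  rw [conjTranspose_halfSum]
  have hherm : (halfSum P Q * pauliOp R * halfSum P Q)ᴴ = halfSum P Q * pauliOp R * halfSum P Q := by
    simp only [Matrix.conjTranspose_mul, conjTranspose_halfSum, conjTranspose_pauliOp,
      Matrix.mul_assoc]
  obtain ⟨c, hc, hRP⟩ := pauliOp_mul R P
  obtain ⟨d, hd, hRPQ⟩ := pauliOp_mul (mulLabel R P) Q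
  have hprod : pauliOp R * pauliOp P * pauliOp Q
      = (c * d) • pauliOp (mulLabel (mulLabel R P) Q) := by
    rw [hRP, Matrix.smul_mul, hRPQ, smul_smul]
  have hexp := halfSum_conj P Q (pauliOp R)
  rw [add_conj_of_anticommute (pauliOp_mul_self P) (pauliOp_mul_self Q) h
    (pauliOp_mul_comm P R) (pauliOp_mul_comm Q R)] at hexp
  have hcd : (c * d) ^ 4 = 1 := by rw [mul_pow, hc, hd, one_mul]
  rcases prod_sign1 P R with hs | hs <;> rcases prod_sign1 Q R with ht | ht <;>
    rw [hs, ht] at hexp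
  · exact ⟨R, Or.inl (by rw [hexp]; norm_num [smul_smul])⟩
  · refine ⟨mulLabel (mulLabel R P) Q, ?_⟩
    have he : halfSum P Q * pauliOp R * halfSum P Q
        = (c * d) • pauliOp (mulLabel (mulLabel R P) Q) := by
      rw [hexp, ← hprod]; norm_num [smul_smul]
    rw [he] at hherm ⊢
    exact smul_pauliOp_of_isHermitian hcd _ hherm
  · refine ⟨mulLabel (mulLabel R P) Q, ?_⟩
    have he : halfSum P Q * pauliOp R * halfSum P Q
        = (-(c * d)) • pauliOp (mulLabel (mulLabel R P) Q) := by
      rw [hexp, neg_smul, ← hprod]; norm_num [smul_smul]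
    rw [he] at hherm ⊢
    exact smul_pauliOp_of_isHermitian (by rw [neg_pow, hcd]; norm_num) _ hherm
  · exact ⟨R, Or.inr (by rw [hexp]; norm_num [smul_smul])⟩

/-- The operator of a Clifford unitary. -/
abbrev opOf (U : cliffordGroup N) : Op N := ((U : Matrix.unitaryGroup (Bitstring N) ℂ) : Op N)

theorem opOf_mul (U V : cliffordGroup N) : opOf (U * V) = opOf U * opOf V := rfl

theorem star_opOf_mul_self (U : cliffordGroup N) : (opOf U)ᴴ * opOf U = 1 :=
  Unitary.coe_star_mul_self (U : Matrix.unitaryGroup (Bitstring N) ℂ)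

theorem opOf_mul_star_self (U : cliffordGroup N) : opOf U * (opOf U)ᴴ = 1 :=
  Unitary.coe_mul_star_self (U : Matrix.unitaryGroup (Bitstring N) ℂ)

theorem exists_clifford_of_anticommute {P Q : PauliString N}
    (h : pauliOp Q * pauliOp P = -(pauliOp P * pauliOp Q)) :
    ∃ W : cliffordGroup N, (opOf W)ᴴ * pauliOp P * opOf W = pauliOp Q := by
  refine ⟨⟨⟨halfSum P Q, ?_⟩, ?_, ?_⟩, ?_⟩
  · rw [Matrix.mem_unitaryGroup_iff, Matrix.star_eq_conjTranspose, conjTranspose_halfSum]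
    exact halfSum_mul_self h
  · exact mapsPaulis_halfSum h
  · change MapsPaulis (halfSum P Q)ᴴ
    rw [conjTranspose_halfSum]
    exact mapsPaulis_halfSum h
  · change (halfSum P Q)ᴴ * _ * halfSum P Q = _
    rw [conjTranspose_halfSum]
    exact halfSum_conj_left h

/-- The intermediate string allows passing from $P$ to $Q$ by two rotations of the form `halfSum`.
If the supports of $P$ and $Q$ meet, one letter at a common site anticommutes with both; otherwise
one letter in each support is used. -/
theorem exists_anticommuting {P Q : PauliString N} (hP : P ≠ 0) (hQ : Q ≠ 0) :
    ∃ R : PauliString N, ∏ i, sign1 (P i) (R i) = -1 ∧ ∏ i, sign1 (R i) (Q i) = -1 := by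
  have h1 : ∀ a b : Fin 4, a ≠ 0 → b ≠ 0 →
      ∃ r : Fin 4, ¬ (a = 0 ∨ r = 0 ∨ a = r) ∧ ¬ (r = 0 ∨ b = 0 ∨ r = b) := by decide
  have h2 : ∀ a : Fin 4, a ≠ 0 → ∃ r : Fin 4, ¬ (a = 0 ∨ r = 0 ∨ a = r) := by decide
  by_cases hboth : ∃ i, P i ≠ 0 ∧ Q i ≠ 0
  · obtain ⟨i, hPi, hQi⟩ := hboth
    obtain ⟨r, hr, hr'⟩ := h1 _ _ hPi hQi
    refine ⟨Function.update 0 i r, ?_, ?_⟩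
    · rw [Finset.prod_eq_single i _ (by simp)]
      · rw [Function.update_self, sign1, if_neg hr]
      · intro j _ hj; simp [Function.update_of_ne hj, sign1]
    · rw [Finset.prod_eq_single i _ (by simp)]
      · rw [Function.update_self, sign1, if_neg hr']
      · intro j _ hj; simp [Function.update_of_ne hj, sign1]
  · push Not at hboth
    obtain ⟨i, hPi⟩ := Function.ne_iff.mp hP
    obtain ⟨j, hQj⟩ := Function.ne_iff.mp hQ
    have hQi : Q i = 0 := hboth i hPi
    have hPj : P j = 0 := by
      by_contra h
      exact hQj (hboth j h)
    have hij : i ≠ j := by rintro rfl; exact hPi hPj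
    obtain ⟨r, hr⟩ := h2 _ hPi
    obtain ⟨s, hs⟩ := h2 _ hQj
    refine ⟨Function.update (Function.update 0 i r) j s, ?_, ?_⟩
    · rw [Finset.prod_eq_single i _ (by simp)]
      · rw [Function.update_of_ne hij, Function.update_self, sign1, if_neg hr]
      · intro l _ hl
        by_cases hlj : l = j
        · subst hlj; simp [sign1, hPj]
        · simp [Function.update_of_ne hlj, Function.update_of_ne hl, sign1]
    · rw [Finset.prod_eq_single j _ (by simp)]
      · rw [Function.update_self, sign1, if_neg]
        tauto
      · intro l _ hl
        by_cases hli : l = i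
        · subst hli; simp [sign1, hQi]
        · simp [Function.update_of_ne hl, Function.update_of_ne hli, sign1]

theorem anticommute_of_prod_sign1 {P Q : PauliString N} (h : ∏ i, sign1 (P i) (Q i) = -1) :
    pauliOp Q * pauliOp P = -(pauliOp P * pauliOp Q) := by
  rw [pauliOp_mul_comm P Q, h, neg_one_smul, neg_neg]

/-- The Clifford group acts transitively on the non-identity Pauli strings. -/
theorem exists_clifford_conj {P Q : PauliString N} (hP : P ≠ 0) (hQ : Q ≠ 0) :
    ∃ W : cliffordGroup N, (opOf W)ᴴ * pauliOp P * opOf W = pauliOp Q := by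
  obtain ⟨R, hR, hR'⟩ := exists_anticommuting hP hQ
  obtain ⟨U, hU⟩ := exists_clifford_of_anticommute (anticommute_of_prod_sign1 hR)
  obtain ⟨V, hV⟩ := exists_clifford_of_anticommute (anticommute_of_prod_sign1 hR')
  refine ⟨U * V, ?_⟩
  rw [opOf_mul, Matrix.conjTranspose_mul, ← hV, ← hU]
  simp only [Matrix.mul_assoc]

/-! ### Uniform distribution of a randomly conjugated Pauli string. -/

instance : (globalPhases N).Normal where
  conj_mem := by
    rintro U ⟨c, hc⟩ V
    refine ⟨c, ?_⟩
    change opOf V * opOf U * (opOf V)ᴴ = c • 1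
    rw [show opOf U = c • 1 from hc]
    simp [opOf_mul_star_self]

theorem conj_phase {U : cliffordGroup N} (hU : U ∈ globalPhases N) (A : Op N) :
    (opOf U)ᴴ * A * opOf U = A := by
  obtain ⟨c, hc⟩ := hU
  have h := star_opOf_mul_self U
  have hc' : opOf U = c • 1 := hc
  rw [hc'] at h ⊢
  simp only [Matrix.conjTranspose_smul, Matrix.conjTranspose_one, Matrix.smul_mul,
    Matrix.mul_smul, one_mul, mul_one, smul_smul] at h ⊢
  calc (c * star c) • A = ((c * star c) • (1 : Op N)) * A := by simp
    _ = A := by rw [h, one_mul]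

/-- The chosen representative differs from $U$ by a global phase, which cancels under conjugation.
-/
theorem toOp_mk_conj (U : cliffordGroup N) (A : Op N) :
    (Clifford.toOp (U : Clifford N))ᴴ * A * Clifford.toOp (U : Clifford N)
      = (opOf U)ᴴ * A * opOf U := by
  obtain ⟨⟨h, hh⟩, hout⟩ := QuotientGroup.mk_out_eq_mul (globalPhases N) U
  change (opOf (Quotient.out (U : Clifford N)))ᴴ * A * opOf (Quotient.out (U : Clifford N)) = _
  rw [hout, opOf_mul, Matrix.conjTranspose_mul, ← conj_phase hh ((opOf U)ᴴ * A * opOf U)]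
  simp only [Matrix.mul_assoc]

theorem toOp_mul_conj (C D : Clifford N) (A : Op N) :
    (Clifford.toOp (C * D))ᴴ * A * Clifford.toOp (C * D)
      = (D.toOp)ᴴ * ((C.toOp)ᴴ * A * C.toOp) * D.toOp := by
  have h : C * D = ((C.out * D.out : cliffordGroup N) : Clifford N) := by
    rw [QuotientGroup.mk_mul, QuotientGroup.out_eq', QuotientGroup.out_eq']
  rw [h, toOp_mk_conj, opOf_mul, Matrix.conjTranspose_mul]
  simp only [Matrix.mul_assoc]
  rfl

open Classical in
/-- The Clifford elements that take `P` to `Q` up to sign. -/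
noncomputable def carriers (P Q : PauliString N) : Finset (Clifford N) :=
  Finset.univ.filter fun C => EqUpToSign ((C.toOp)ᴴ * pauliOp P * C.toOp) (pauliOp Q)

theorem mem_carriers {P Q : PauliString N} {C : Clifford N} :
    C ∈ carriers P Q ↔ EqUpToSign ((C.toOp)ᴴ * pauliOp P * C.toOp) (pauliOp Q) := by
  simp [carriers]

/-- Right multiplication by a Clifford element taking $Q$ to $Q'$ injects one set into the other. By
symmetry all these sets have the same size. -/
theorem card_carriers_le {P Q Q' : PauliString N} (hQ : Q ≠ 0) (hQ' : Q' ≠ 0) :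
    (carriers P Q).card ≤ (carriers P Q').card := by
  obtain ⟨W, hW⟩ := exists_clifford_conj hQ hQ'
  refine Finset.card_le_card_of_injOn (fun C => C * (W : Clifford N)) ?_
    (fun C _ D _ h => mul_right_cancel h)
  intro C hC
  rw [Finset.mem_coe, mem_carriers] at hC ⊢
  rw [toOp_mul_conj, ← hW, toOp_mk_conj]
  exact hC.conj _ _

theorem carriers_zero {P : PauliString N} (hP : P ≠ 0) : carriers P 0 = ∅ := by
  refine Finset.eq_empty_of_forall_notMem fun C hC => hP ?_
  rw [mem_carriers, pauliOp_zero] at hC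
  have h := hC.conj C.toOp (C.toOp)ᴴ
  have h1 : C.toOp * (C.toOp)ᴴ = 1 := opOf_mul_star_self C.out
  have h2 : C.toOp * ((C.toOp)ᴴ * pauliOp P * C.toOp) * (C.toOp)ᴴ = pauliOp P := by
    calc _ = (C.toOp * (C.toOp)ᴴ) * pauliOp P * (C.toOp * (C.toOp)ᴴ) := by
          simp only [Matrix.mul_assoc]
      _ = _ := by simp [h1]
  rw [h2, mul_one, h1, ← pauliOp_zero] at h
  exact h.label_eq

/-- A uniformly random Clifford unitary maps a non-identity Pauli string to any given one with
probability at most `1 / (4 ^ N - 1)`. -/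
theorem card_carriers_mul_le {P : PauliString N} (hP : P ≠ 0) (Q : PauliString N) :
    (carriers P Q).card * (4 ^ N - 1) ≤ Fintype.card (Clifford N) := by
  classical
  by_cases hQ : Q = 0
  · rw [hQ, carriers_zero hP]; simp
  have hdisj : ∀ Q ∈ (Finset.univ.erase (0 : PauliString N)),
      ∀ Q' ∈ (Finset.univ.erase (0 : PauliString N)), Q ≠ Q' →
        Disjoint (carriers P Q) (carriers P Q') := by
    intro Q _ Q' _ hne
    rw [Finset.disjoint_left]
    intro C hC hC'
    rw [mem_carriers] at hC hC'
    exact hne (hC.symm.trans hC').label_eq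
  -- The $4^N-1$ sets for non-identity targets are pairwise disjoint and none is smaller than the
  -- given one.
  calc (carriers P Q).card * (4 ^ N - 1)
      = ∑ _Q' ∈ (Finset.univ.erase (0 : PauliString N)), (carriers P Q).card := by
        rw [Finset.sum_const, Finset.card_erase_of_mem (Finset.mem_univ _), smul_eq_mul, mul_comm]
        simp
    _ ≤ ∑ Q' ∈ (Finset.univ.erase (0 : PauliString N)), (carriers P Q').card :=
        Finset.sum_le_sum fun Q' hQ' => card_carriers_le hQ (Finset.ne_of_mem_erase hQ')
    _ = ((Finset.univ.erase (0 : PauliString N)).biUnion fun Q' => carriers P Q').card :=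
        (Finset.card_biUnion hdisj).symm
    _ ≤ _ := Finset.card_le_univ _

/-! ### Bit flips of conjugated Pauli strings. -/

variable {T kc k nc m : ℕ}

theorem exists_conj_label (W : cliffordGroup N) (P : PauliString N) :
    ∃ Q : PauliString N, EqUpToSign ((opOf W)ᴴ * pauliOp P * opOf W) (pauliOp Q) := by
  obtain ⟨Q, hQ⟩ := W.2.2 P
  rw [Matrix.conjTranspose_conjTranspose] at hQ
  exact ⟨Q, hQ⟩

/-- The bits flipped by the Pauli string `W† P W`. -/
noncomputable def conjFlips (W : cliffordGroup N) (P : PauliString N) : Bitstring N :=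
  flips (exists_conj_label W P).choose

theorem conjFlips_eq {W : cliffordGroup N} {P Q : PauliString N}
    (h : EqUpToSign ((opOf W)ᴴ * pauliOp P * opOf W) (pauliOp Q)) : conjFlips W P = flips Q := by
  rw [conjFlips, ((exists_conj_label W P).choose_spec.symm.trans h).label_eq]

theorem norm_conj_zero_col (W : cliffordGroup N) (P : PauliString N) (z : Bitstring N) :
    ‖((opOf W)ᴴ * pauliOp P * opOf W) z 0‖ ^ 2 = if z = conjFlips W P then 1 else 0 := by
  obtain ⟨Q, hQ⟩ := exists_conj_label W P
  rw [conjFlips_eq hQ, ← norm_pauliOp_zero_col]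
  rcases hQ with h | h <;> rw [h]
  simp

theorem mul_conj_of_mul_eq_one {M : Type*} [Monoid M] {u v : M} (h : u * v = 1) (p q : M) :
    v * (p * q) * u = (v * p * u) * (v * q * u) := by
  calc v * (p * q) * u = v * p * (u * v) * q * u := by rw [h, mul_one]; simp only [mul_assoc]
    _ = _ := by simp only [mul_assoc]

/-- Conjugation is multiplicative and flip patterns add modulo 2, so equal patterns cancel. A
collision of two strings at the same time step thus becomes an event about one string, their
product. -/
theorem conjFlips_mulLabel {W : cliffordGroup N} {P P' : PauliString N}
    (h : conjFlips W P = conjFlips W P') : conjFlips W (mulLabel P P') = 0 := by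
  obtain ⟨Q, hQ⟩ := exists_conj_label W P
  obtain ⟨Q', hQ'⟩ := exists_conj_label W P'
  obtain ⟨R, hR⟩ := exists_conj_label W (mulLabel P P')
  rw [conjFlips_eq hQ, conjFlips_eq hQ', ← flips_mulLabel] at h
  rw [conjFlips_eq hR, ← h]
  congr 1
  obtain ⟨c, hc, hPP⟩ := pauliOp_mul P P'
  obtain ⟨d, hd, hQQ⟩ := pauliOp_mul Q Q'
  have hc0 : c ≠ 0 := by rintro rfl; norm_num at hc
  have hmul : EqUpToSign (c • ((opOf W)ᴴ * pauliOp (mulLabel P P') * opOf W))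
      (d • pauliOp (mulLabel Q Q')) := by
    have h1 : c • ((opOf W)ᴴ * pauliOp (mulLabel P P') * opOf W)
        = ((opOf W)ᴴ * pauliOp P * opOf W) * ((opOf W)ᴴ * pauliOp P' * opOf W) := by
      rw [← mul_conj_of_mul_eq_one (opOf_mul_star_self W), hPP, Matrix.mul_smul, Matrix.smul_mul]
    rw [h1, ← hQQ]
    exact hQ.mul hQ'
  rcases hmul with h1 | h1 <;> rcases hR with h2 | h2 <;> rw [h2] at h1
  · refine label_eq_of_eq_smul (c := c⁻¹ * d) ?_
    rw [mul_smul, ← h1, smul_smul, inv_mul_cancel₀ hc0, one_smul]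
  · refine label_eq_of_eq_smul (c := -(c⁻¹ * d)) ?_
    rw [neg_smul, mul_smul, ← h1, smul_neg, smul_neg, neg_neg, smul_smul, inv_mul_cancel₀ hc0,
      one_smul]
  · refine label_eq_of_eq_smul (c := -(c⁻¹ * d)) ?_
    rw [neg_smul, mul_smul, ← smul_neg, ← h1, smul_smul, inv_mul_cancel₀ hc0, one_smul]
  · refine label_eq_of_eq_smul (c := c⁻¹ * d) ?_
    rw [smul_neg, neg_inj] at h1
    rw [mul_smul, ← h1, smul_smul, inv_mul_cancel₀ hc0, one_smul]

/-- Undoing the fixed conjugation by $W$ turns the event into a union over the $2^N$ strings with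
flip pattern $z$; for each of them $C$ must carry $P$ to one prescribed string. -/
theorem card_conjFlips_eq_mul_le {P : PauliString N} (hP : P ≠ 0) (W : cliffordGroup N)
    (z : Bitstring N) :
    (Finset.univ.filter fun C : Clifford N => conjFlips (C.out * W) P = z).card * (4 ^ N - 1)
      ≤ 2 ^ N * Fintype.card (Clifford N) := by
  classical
  have hback : ∀ Q : PauliString N, ∃ R : PauliString N,
      EqUpToSign (opOf W * pauliOp Q * (opOf W)ᴴ) (pauliOp R) := fun Q => W.2.1 Q
  choose R hR using hback
  have hsub : (Finset.univ.filter fun C : Clifford N => conjFlips (C.out * W) P = z) ⊆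
      (Finset.univ.filter fun Q : PauliString N => flips Q = z).biUnion
        fun Q => carriers P (R Q) := by
    intro C hC
    rw [Finset.mem_filter] at hC
    obtain ⟨Q, hQ⟩ := exists_conj_label (C.out * W) P
    rw [Finset.mem_biUnion]
    refine ⟨Q, ?_, ?_⟩
    · rw [Finset.mem_filter, ← hC.2, conjFlips_eq hQ]
      exact ⟨Finset.mem_univ _, rfl⟩
    · rw [mem_carriers]
      have h := (hQ.conj (opOf W) (opOf W)ᴴ).trans (hR Q)
      rw [opOf_mul, Matrix.conjTranspose_mul] at h
      have h1 : opOf W * ((opOf W)ᴴ * (opOf C.out)ᴴ * pauliOp P * (opOf C.out * opOf W)) * (opOf W)ᴴ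
          = (C.toOp)ᴴ * pauliOp P * C.toOp := by
        calc _ = (opOf W * (opOf W)ᴴ) * (opOf C.out)ᴴ * pauliOp P * opOf C.out *
              (opOf W * (opOf W)ᴴ) := by simp only [Matrix.mul_assoc]
          _ = _ := by rw [opOf_mul_star_self, one_mul, mul_one]; rfl
      rwa [h1] at h
  calc _ ≤ (∑ Q ∈ Finset.univ.filter fun Q : PauliString N => flips Q = z,
        (carriers P (R Q)).card) * (4 ^ N - 1) :=
        Nat.mul_le_mul_right _ ((Finset.card_le_card hsub).trans Finset.card_biUnion_le)
    _ = ∑ Q ∈ Finset.univ.filter fun Q : PauliString N => flips Q = z,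
        (carriers P (R Q)).card * (4 ^ N - 1) := Finset.sum_mul _ _ _
    _ ≤ ∑ _Q ∈ Finset.univ.filter fun Q : PauliString N => flips Q = z,
        Fintype.card (Clifford N) :=
        Finset.sum_le_sum fun Q _ => card_carriers_mul_le hP _
    _ = _ := by rw [Finset.sum_const, card_flips, smul_eq_mul]

/-! ### Column supports and their collision probability. -/

/-- The product of the first `j` representatives of a circuit, as a Clifford unitary. -/
noncomputable def prefixProd (C : Fin T → Clifford N) (j : ℕ) : cliffordGroup N :=
  ((List.finRange T).take j).foldl (fun U t => (C t).out * U) 1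

theorem opOf_prefixProd (C : Fin T → Clifford N) (j : ℕ) :
    opOf (prefixProd C j) = partialCircuit C j :=
  (List.foldl_hom (opOf (N := N)) fun _ _ => rfl).symm

theorem prefixProd_succ (C : Fin T → Clifford N) (t : Fin T) :
    prefixProd C (t + 1) = (C t).out * prefixProd C t := by
  have h : (List.finRange T).take (t + 1) = (List.finRange T).take t ++ [t] := by
    rw [List.take_add_one]
    simp
  rw [prefixProd, h, List.foldl_append]
  rfl

/-- The first $j$ factors have time indices below $j\le t$, so the gate at $t$ is not among them. -/
theorem prefixProd_update (C : Fin T → Clifford N) (t : Fin T) (c : Clifford N) {j : ℕ}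
    (hj : j ≤ t) : prefixProd (Function.update C t c) j = prefixProd C j := by
  refine List.foldl_ext _ _ _ fun U s hs => ?_
  have hst : s ≠ t := by
    rintro rfl
    rw [List.mem_take_iff_getElem] at hs
    obtain ⟨i, hi, h⟩ := hs
    have h2 := congrArg Fin.val h
    simp at h2 hi
    omega
  rw [Function.update_of_ne hst]

/-- The bitstring on which a column of the regression matrix of one circuit is supported. -/
noncomputable def Signals.support (S : Signals N T kc k) (C : Fin T → Clifford N) :
    Option (Fin k × Fin T) → Bitstring N
  | none => 0
  | some s => conjFlips (prefixProd C (s.2 + 1)) (S.incPauli s.1)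

theorem Signals.design_apply (S : Signals N T kc k) (C : Fin nc → Fin T → Clifford N)
    (r : Fin nc × Bitstring N) (c : Option (Fin k × Fin T)) :
    S.design C r c = if r.2 = S.support (C r.1) c then 1 else 0 := by
  cases c with
  | none => rfl
  | some s =>
    rw [Signals.support, ← norm_conj_zero_col, opOf_prefixProd]
    rfl

/-- Conditioning on all coordinates but $i$: if every conditional probability is at most $L/M$, so
is the total one. Exchanging coordinate $i$ with a fresh copy is an involution, hence preserves
counting. -/
theorem card_mul_le_of_update {ι G : Type*} [Fintype ι] [Fintype G] [DecidableEq ι] (i : ι)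
    (E : (ι → G) → Prop) [DecidablePred E] (L M : ℕ)
    (h : ∀ C : ι → G, (Finset.univ.filter fun c => E (Function.update C i c)).card * M
      ≤ L * Fintype.card G) :
    (Finset.univ.filter E).card * M ≤ L * Fintype.card (ι → G) := by
  rcases isEmpty_or_nonempty G with hG | hG
  · have : IsEmpty (ι → G) := ⟨fun f => hG.elim (f i)⟩
    rw [Finset.eq_empty_of_isEmpty (Finset.univ.filter E)]
    simp
  let e : (ι → G) × G → (ι → G) × G := fun p => (Function.update p.1 i p.2, p.1 i)
  have he : Function.Involutive e := by
    rintro ⟨C, c⟩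
    simp [e]
  have hcount : (Finset.univ.filter E).card * Fintype.card G
      = ∑ C : ι → G, (Finset.univ.filter fun c => E (Function.update C i c)).card := by
    calc (Finset.univ.filter E).card * Fintype.card G
        = ∑ C : ι → G, ∑ _c : G, if E C then 1 else 0 := by
          rw [Finset.card_filter, Finset.sum_mul]
          refine Finset.sum_congr rfl fun C _ => ?_
          rw [Finset.sum_const, Finset.card_univ, smul_eq_mul, mul_comm]
      _ = ∑ p : (ι → G) × G, if E p.1 then 1 else 0 := by rw [Fintype.sum_prod_type]
      _ = ∑ p : (ι → G) × G, if E (e p).1 then 1 else 0 :=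
          (Equiv.sum_comp he.toPerm fun p : (ι → G) × G => if E p.1 then 1 else 0).symm
      _ = ∑ C : ι → G, ∑ c : G, if E (Function.update C i c) then 1 else 0 := by
          rw [Fintype.sum_prod_type]
      _ = _ := by simp only [Finset.card_filter]
  refine Nat.le_of_mul_le_mul_right ?_ (Fintype.card_pos (α := G))
  calc (Finset.univ.filter E).card * M * Fintype.card G
      = (∑ C : ι → G, (Finset.univ.filter fun c => E (Function.update C i c)).card) * M := by
        rw [← hcount]; ring
    _ = ∑ C : ι → G, (Finset.univ.filter fun c => E (Function.update C i c)).card * M :=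
        Finset.sum_mul _ _ _
    _ ≤ ∑ _C : ι → G, L * Fintype.card G := Finset.sum_le_sum fun C _ => h C
    _ = _ := by rw [Finset.sum_const, smul_eq_mul, Finset.card_univ]; ring

theorem card_mul_le_of_conjFlips (t : Fin T)
    (E : (Fin T → Clifford N) → Prop) [DecidablePred E] (P : PauliString N) (hP : P ≠ 0)
    (z : (Fin T → Clifford N) → Bitstring N)
    (h : ∀ C c, E (Function.update C t c) → conjFlips (c.out * prefixProd C t) P = z C) :
    (Finset.univ.filter E).card * (4 ^ N - 1)
      ≤ 2 ^ N * Fintype.card (Fin T → Clifford N) := by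
  refine card_mul_le_of_update t E _ _ fun C => ?_
  refine le_trans (Nat.mul_le_mul_right _ (Finset.card_le_card ?_))
    (card_conjFlips_eq_mul_le hP (prefixProd C t) (z C))
  intro c hc
  rw [Finset.mem_filter] at hc ⊢
  exact ⟨hc.1, h C c hc.2⟩

theorem Signals.support_update_self (S : Signals N T kc k) (C : Fin T → Clifford N) (β : Fin k)
    (t : Fin T) (c : Clifford N) :
    S.support (Function.update C t c) (some (β, t))
      = conjFlips (c.out * prefixProd C t) (S.incPauli β) := by
  rw [Signals.support, prefixProd_succ, Function.update_self, prefixProd_update C t c le_rfl]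

/-- Two columns of the regression matrix of a random circuit coincide with probability at most
`2 ^ N / (4 ^ N - 1)`. -/
theorem Signals.card_collision_mul_le (S : Signals N T kc k) (hinj : Function.Injective S.incPauli)
    (hne : ∀ β, S.incPauli β ≠ 0) {a b : Option (Fin k × Fin T)} (hab : a ≠ b) :
    (Finset.univ.filter fun C : Fin T → Clifford N => S.support C a = S.support C b).card *
      (4 ^ N - 1) ≤ 2 ^ N * Fintype.card (Fin T → Clifford N) := by
  have hnone : ∀ β t, (Finset.univ.filter fun C : Fin T → Clifford N =>
      S.support C (some (β, t)) = S.support C none).card * (4 ^ N - 1)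
        ≤ 2 ^ N * Fintype.card (Fin T → Clifford N) := by
    intro β t
    refine card_mul_le_of_conjFlips t _ (S.incPauli β) (hne β) (fun _ => 0) ?_
    intro C c h
    rwa [S.support_update_self] at h
  -- The earlier column uses gates up to $t'<t$ only, so it stays fixed while the gate at $t$ is
  -- resampled.
  have hlt : ∀ β t β' t', t' < t → (Finset.univ.filter fun C : Fin T → Clifford N =>
      S.support C (some (β, t)) = S.support C (some (β', t'))).card * (4 ^ N - 1)
        ≤ 2 ^ N * Fintype.card (Fin T → Clifford N) := by
    intro β t β' t' htt
    refine card_mul_le_of_conjFlips t _ (S.incPauli β) (hne β)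
      (fun C => S.support C (some (β', t'))) ?_
    intro C c h
    rw [S.support_update_self] at h
    rw [h, Signals.support, Signals.support, prefixProd_update C t c (j := t' + 1) htt]
  -- At equal times both columns move with the same gate. Distinctness of the generators makes their
  -- product a non-identity string, which must then flip nothing.
  have heq : ∀ β β' t, β ≠ β' → (Finset.univ.filter fun C : Fin T → Clifford N =>
      S.support C (some (β, t)) = S.support C (some (β', t))).card * (4 ^ N - 1)
        ≤ 2 ^ N * Fintype.card (Fin T → Clifford N) := by
    intro β β' t hββ
    refine card_mul_le_of_conjFlips t _ (mulLabel (S.incPauli β) (S.incPauli β'))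
      (fun h0 => hββ (hinj (mulLabel_eq_zero h0))) (fun _ => 0) ?_
    intro C c h
    rw [S.support_update_self, S.support_update_self] at h
    exact conjFlips_mulLabel h
  rcases a with _ | ⟨β, t⟩ <;> rcases b with _ | ⟨β', t'⟩
  · exact absurd rfl hab
  · simpa only [eq_comm] using hnone β' t'
  · exact hnone β t
  · rcases lt_trichotomy t t' with h | rfl | h
    · simpa only [eq_comm] using hlt β' t' β t h
    · exact heq β β' t fun h => hab (by rw [h])
    · exact hlt β t β' t' h

/-! ### Isolated columns and a Chernoff bound over the circuits. -/

/-- The column `a` of the regression matrix of one circuit shares its support with no other. -/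
def Signals.Isolated (S : Signals N T kc k) (a : Option (Fin k × Fin T))
    (C : Fin T → Clifford N) : Prop :=
  ∀ b, b ≠ a → S.support C b ≠ S.support C a

open Classical in
/-- The number of circuits in which the column `a` is isolated. -/
noncomputable def Signals.isolatedCount (S : Signals N T kc k) (C : Fin nc → Fin T → Clifford N)
    (a : Option (Fin k × Fin T)) : ℕ :=
  (Finset.univ.filter fun n => S.Isolated a (C n)).card

-- Union bound over the $kT$ other columns. The factor $4/3$ comes from $4^N-1\ge\tfrac34 4^N$,
-- valid for $N\ge1$.
open Classical in
theorem Signals.card_not_isolated_le (S : Signals N T kc k) (hN : 1 ≤ N)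
    (hinj : Function.Injective S.incPauli) (hne : ∀ β, S.incPauli β ≠ 0)
    (a : Option (Fin k × Fin T)) :
    ((Finset.univ.filter fun C : Fin T → Clifford N => ¬ S.Isolated a C).card : ℝ)
      ≤ 4 / 3 * (((k * T : ℕ) : ℝ) / 2 ^ N) * Fintype.card (Fin T → Clifford N) := by
  have hsub : (Finset.univ.filter fun C : Fin T → Clifford N => ¬ S.Isolated a C) ⊆
      (Finset.univ.erase a).biUnion fun b =>
        Finset.univ.filter fun C : Fin T → Clifford N => S.support C b = S.support C a := by
    intro C hC
    simp only [Finset.mem_filter, Signals.Isolated, not_forall, not_not, Finset.mem_univ,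
      true_and] at hC
    obtain ⟨b, hb, h⟩ := hC
    simp only [Finset.mem_biUnion, Finset.mem_filter, Finset.mem_erase, Finset.mem_univ, true_and,
      and_true]
    exact ⟨b, hb, h⟩
  have hcard : (Finset.univ.erase a).card = k * T := by
    rw [Finset.card_erase_of_mem (Finset.mem_univ _), Finset.card_univ]
    simp
  have hnat : (Finset.univ.filter fun C : Fin T → Clifford N => ¬ S.Isolated a C).card *
      (4 ^ N - 1) ≤ k * T * (2 ^ N * Fintype.card (Fin T → Clifford N)) := by
    calc _ ≤ (∑ b ∈ Finset.univ.erase a, (Finset.univ.filter fun C : Fin T → Clifford N =>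
            S.support C b = S.support C a).card) * (4 ^ N - 1) :=
          Nat.mul_le_mul_right _ ((Finset.card_le_card hsub).trans Finset.card_biUnion_le)
      _ = ∑ b ∈ Finset.univ.erase a, (Finset.univ.filter fun C : Fin T → Clifford N =>
            S.support C b = S.support C a).card * (4 ^ N - 1) := Finset.sum_mul _ _ _
      _ ≤ ∑ _b ∈ Finset.univ.erase a, 2 ^ N * Fintype.card (Fin T → Clifford N) :=
          Finset.sum_le_sum fun b hb =>
            S.card_collision_mul_le hinj hne (Finset.ne_of_mem_erase hb)
      _ = _ := by rw [Finset.sum_const, hcard, smul_eq_mul]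
  generalize (Finset.univ.filter fun C : Fin T → Clifford N => ¬ S.Isolated a C).card = x at *
  generalize Fintype.card (Fin T → Clifford N) = y at *
  have h4 : 4 ≤ 4 ^ N := by simpa using Nat.pow_le_pow_right (n := 4) (by norm_num) hN
  have hreal : (x : ℝ) * (4 ^ N - 1) ≤ ((k * T : ℕ) : ℝ) * (2 ^ N * y) := by
    have := (Nat.cast_le (α := ℝ)).mpr hnat
    rw [Nat.cast_mul, Nat.cast_sub (by omega), Nat.cast_mul (k * T)] at this
    simpa using this
  have h4' : (4 : ℝ) ≤ 4 ^ N := by exact_mod_cast h4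
  have h2 : (4 : ℝ) ^ N = 2 ^ N * 2 ^ N := by rw [← mul_pow]; norm_num
  have h2pos : (0 : ℝ) < 2 ^ N := by positivity
  have hx : (0 : ℝ) ≤ x := Nat.cast_nonneg _
  have h5 : (x : ℝ) * (3 / 4 * 4 ^ N) ≤ ((k * T : ℕ) : ℝ) * (2 ^ N * y) :=
    le_trans (mul_le_mul_of_nonneg_left (by linarith) hx) hreal
  have h6 : (x : ℝ) * 2 ^ N ≤ 4 / 3 * ((k * T : ℕ) : ℝ) * y := by
    refine le_of_mul_le_mul_right ?_ h2pos
    rw [h2] at h5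
    linarith
  calc (x : ℝ) = x * 2 ^ N / 2 ^ N := by field_simp
    _ ≤ 4 / 3 * ((k * T : ℕ) : ℝ) * y / 2 ^ N := by gcongr
    _ = _ := by ring

open Classical in
/-- A Chernoff bound: successes that fail with probability at most `r` seldom make up less than a
sixteenth of `nc` independent trials. -/
theorem card_few_successes_le {G : Type*} [Fintype G] (p : G → Prop) {r y : ℝ} (hy : 0 < y)
    (hy1 : y ≤ 1) (hr : ((Finset.univ.filter fun g => ¬ p g).card : ℝ) ≤ r * Fintype.card G)
    (nc : ℕ) :
    ((Finset.univ.filter fun C : Fin nc → G =>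
      16 * (Finset.univ.filter fun n => p (C n)).card < nc).card : ℝ) * y ^ nc
        ≤ (y ^ 16 + r) ^ nc * Fintype.card (Fin nc → G) := by
  have hsum : ∑ g : G, (if p g then y ^ 16 else 1) ≤ (y ^ 16 + r) * Fintype.card G := by
    calc ∑ g : G, (if p g then y ^ 16 else 1)
        ≤ ∑ g : G, (y ^ 16 + if ¬ p g then 1 else 0) := by
          refine Finset.sum_le_sum fun g _ => ?_
          by_cases h : p g
          · simp [h]
          · simp only [h, if_false, not_false_eq_true, if_true]
            linarith [pow_pos hy 16]
      _ = Fintype.card G * y ^ 16 + ((Finset.univ.filter fun g => ¬ p g).card : ℝ) := by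
          rw [Finset.sum_add_distrib, Finset.sum_const, Finset.card_univ, nsmul_eq_mul,
            Finset.sum_boole]
      _ ≤ _ := by linarith
  have hcount : ∀ C : Fin nc → G, ∏ n, (if p (C n) then y ^ 16 else 1)
      = y ^ (16 * (Finset.univ.filter fun n => p (C n)).card) := by
    intro C
    rw [← Finset.prod_filter, Finset.prod_const, ← pow_mul]
  set few := Finset.univ.filter fun C : Fin nc → G =>
    16 * (Finset.univ.filter fun n => p (C n)).card < nc with hfew
  have hmem : ∀ C ∈ few, 16 * (Finset.univ.filter fun n => p (C n)).card < nc := by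
    intro C hC
    simpa only [hfew, Finset.mem_filter, Finset.mem_univ, true_and] using hC
  clear_value few
  -- Exponential Markov inequality: the weight $y^{16\cdot\#\text{successes}}$ is at least $y^{n_c}$
  -- when successes are few, and its sum factorizes over the trials.
  calc (few.card : ℝ) * y ^ nc = ∑ C ∈ few, y ^ nc := by
        rw [Finset.sum_const, nsmul_eq_mul]
    _ ≤ ∑ C ∈ few, ∏ n, (if p (C n) then y ^ 16 else 1) := by
        refine Finset.sum_le_sum fun C hC => ?_
        rw [hcount]
        exact pow_le_pow_of_le_one hy.le hy1 (hmem C hC).le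
    _ ≤ ∑ C : Fin nc → G, ∏ n, (if p (C n) then y ^ 16 else 1) := by
        refine Finset.sum_le_sum_of_subset_of_nonneg (Finset.subset_univ _) fun C _ _ => ?_
        rw [hcount]
        positivity
    _ = (∑ g : G, (if p g then y ^ 16 else 1)) ^ nc := by
        rw [Fintype.sum_pow (fun g => if p g then y ^ 16 else 1) nc]
    _ ≤ ((y ^ 16 + r) * Fintype.card G) ^ nc := by
        refine pow_le_pow_left₀ (Finset.sum_nonneg fun g _ => ?_) hsum nc
        split_ifs <;> positivity
    _ = _ := by rw [mul_pow, Fintype.card_fun, Fintype.card_fin, Nat.cast_pow]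

/-- The numerator is $\tfrac{17}{12}\rho$, and $(17/12)^{16}2^{-12}\le\tfrac1{12}$ absorbs the
constants, at the price of keeping only $\rho^3$. -/
theorem chernoff_factor_le {ρ y : ℝ} (hρ : 0 < ρ) (hρ2 : ρ ≤ 1 / 2)
    (hyρ : y ^ 16 = ρ / 12) : ((y ^ 16 + 4 / 3 * ρ) / y) ^ 16 ≤ ρ ^ 3 := by
  have h1 : ρ ^ 12 ≤ (1 / 2) ^ 12 := pow_le_pow_left₀ hρ.le hρ2 12
  rw [div_pow, hyρ, div_le_iff₀ (by positivity)]
  calc (ρ / 12 + 4 / 3 * ρ) ^ 16 = (17 / 12) ^ 16 * ρ ^ 12 * ρ ^ 4 := by ring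
    _ ≤ (17 / 12) ^ 16 * (1 / 2) ^ 12 * ρ ^ 4 := by gcongr
    _ ≤ 1 / 12 * ρ ^ 4 := by
        gcongr
        norm_num
    _ = _ := by ring

open Classical in
/-- With high probability, every column is isolated in at least a sixteenth of the circuits. -/
theorem Signals.card_exists_isolatedCount_lt_le (S : Signals N T kc k) (hN : 1 ≤ N)
    (hinj : Function.Injective S.incPauli) (hne : ∀ β, S.incPauli β ≠ 0)
    (hK : 2 * (k * T) ≤ 2 ^ N) {δ : ℝ} (hδ : 0 < δ) (hδ1 : δ < 1)
    (hKδ : 2 * δ ≤ ((k * T : ℕ) : ℝ)) (hnc : 16 * circuitBound N (k * T) δ ≤ nc) :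
    ((Finset.univ.filter fun C : Fin nc → Fin T → Clifford N =>
      ∃ a, 16 * S.isolatedCount C a < nc).card : ℝ)
        ≤ δ / 2 * Fintype.card (Fin nc → Fin T → Clifford N) := by
  have hK1 : 1 ≤ k * T := by
    rcases Nat.eq_zero_or_pos (k * T) with h | h
    · rw [h, Nat.cast_zero] at hKδ; linarith
    · exact h
  have hcardopt : Fintype.card (Option (Fin k × Fin T)) = k * T + 1 := by simp
  have hbad : ∀ a, _ := S.card_not_isolated_le hN hinj hne
  unfold circuitBound at hnc
  have hK2 : 2 * ((k * T : ℕ) : ℝ) ≤ 2 ^ N := by exact_mod_cast hK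
  generalize k * T = K at *
  set κ : ℝ := (K : ℝ)
  have hκ1 : (1 : ℝ) ≤ κ := Nat.one_le_cast.mpr hK1
  have hκ : 0 < κ := by linarith
  have hpow : (0 : ℝ) < 2 ^ N := by positivity
  set ρ : ℝ := κ / 2 ^ N with hρdef
  have hρ : 0 < ρ := by positivity
  have hρ2 : ρ ≤ 1 / 2 := by rw [hρdef, div_le_iff₀ hpow]; linarith
  obtain ⟨y, hy, hyρ⟩ : ∃ y : ℝ, 0 < y ∧ y ^ 16 = ρ / 12 := by
    refine ⟨(ρ / 12) ^ ((16 : ℕ) : ℝ)⁻¹, by positivity, ?_⟩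
    exact Real.rpow_inv_natCast_pow (by positivity) (by norm_num)
  have hy1 : y ≤ 1 := by
    by_contra h
    have := one_lt_pow₀ (not_le.mp h) (n := 16) (by norm_num)
    linarith
  set B := (y ^ 16 + 4 / 3 * ρ) / y with hB
  have hB0 : 0 < B := by positivity
  set x : ℝ := δ / κ ^ 2 with hx
  have hx0 : 0 < x := by positivity
  have hx1 : x ≤ 1 / 2 := by
    rw [hx, div_le_iff₀ (by positivity)]
    nlinarith
  -- This is the hypothesis on the number of circuits, exponentiated: $\log(2^N/K)=-\log\rho$ and
  -- $\log(K^2/\delta)=-\log x$.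
  have hρx : ρ ^ nc ≤ x ^ 16 := by
    have hlog2 : (0 : ℝ) < Real.log (2 ^ N / κ) := by
      refine Real.log_pos ?_
      rw [one_lt_div hκ]; linarith
    rw [mul_div_assoc', div_le_iff₀ hlog2] at hnc
    have h1 : Real.log (κ ^ 2 / δ) = -Real.log x := by rw [hx, ← Real.log_inv, inv_div]
    have h2 : Real.log (2 ^ N / κ) = -Real.log ρ := by rw [hρdef, ← Real.log_inv, inv_div]
    rw [← Real.log_le_log_iff (by positivity) (by positivity), Real.log_pow, Real.log_pow]
    rw [h1, h2] at hnc
    push_cast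
    linarith
  have hBx : B ^ nc ≤ x ^ 3 := by
    refine le_of_pow_le_pow_left₀ (n := 16) (by norm_num) (by positivity) ?_
    calc (B ^ nc) ^ 16 = (B ^ 16) ^ nc := by rw [← pow_mul, ← pow_mul, mul_comm]
      _ ≤ (ρ ^ 3) ^ nc := by
          exact pow_le_pow_left₀ (by positivity) (chernoff_factor_le hρ hρ2 hyρ) nc
      _ = (ρ ^ nc) ^ 3 := by rw [← pow_mul, ← pow_mul, mul_comm]
      _ ≤ (x ^ 16) ^ 3 := pow_le_pow_left₀ (by positivity) hρx 3
      _ = _ := by rw [← pow_mul, ← pow_mul]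
  set Z : ℝ := (Fintype.card (Fin nc → Fin T → Clifford N) : ℝ) with hZ
  have hZ0 : 0 ≤ Z := Nat.cast_nonneg _
  have hone : ∀ a, ((Finset.univ.filter fun C : Fin nc → Fin T → Clifford N =>
      16 * S.isolatedCount C a < nc).card : ℝ) ≤ B ^ nc * Z := by
    intro a
    have h := card_few_successes_le (S.Isolated a) hy hy1 (hbad a) nc
    rw [← le_div_iff₀ (by positivity), mul_div_right_comm, ← div_pow] at h
    exact h
  calc _ ≤ ((∑ a, (Finset.univ.filter fun C : Fin nc → Fin T → Clifford N =>
          16 * S.isolatedCount C a < nc).card : ℕ) : ℝ) := by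
        refine Nat.cast_le.mpr (le_trans (Finset.card_le_card ?_) Finset.card_biUnion_le)
        intro C hC
        simpa using hC
    _ ≤ ∑ _a : Option (Fin k × Fin T), B ^ nc * Z := by
        push_cast
        exact Finset.sum_le_sum fun a _ => hone a
    _ = (κ + 1) * B ^ nc * Z := by
        rw [Finset.sum_const, Finset.card_univ, hcardopt, nsmul_eq_mul]
        push_cast
        ring
    -- There are $K+1$ columns. One factor $x=\delta/K^2$ pays for this union bound and the other
    -- two, at most $\tfrac12$ each, for the constant.
    _ ≤ (κ + 1) * x ^ 3 * Z := by gcongr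
    _ ≤ δ / 2 * Z := by
        refine mul_le_mul_of_nonneg_right ?_ hZ0
        have hxκ : x * κ ^ 2 = δ := by rw [hx]; field_simp
        have h3 : x ^ 3 ≤ x / 4 := by nlinarith [mul_nonneg hx0.le hx0.le]
        have h4 : x * κ ≤ x * κ ^ 2 := by
          refine mul_le_mul_of_nonneg_left ?_ hx0.le
          nlinarith
        nlinarith

/-! ### Conditioning of the Gram matrix. -/

/-- The quadratic form is $\|Vu\|^2$, and in each circuit where $a$ is isolated the row at its
support has the entry $u_a$. -/
theorem Signals.isolatedCount_mul_sq_le (S : Signals N T kc k) (C : Fin nc → Fin T → Clifford N)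
    (a : Option (Fin k × Fin T)) (u : Option (Fin k × Fin T) → ℝ) :
    (S.isolatedCount C a : ℝ) * u a ^ 2
      ≤ u ⬝ᵥ (((S.design C)ᵀ * S.design C) *ᵥ u) := by
  classical
  have hquad : u ⬝ᵥ (((S.design C)ᵀ * S.design C) *ᵥ u) = ∑ r, ((S.design C) *ᵥ u) r ^ 2 := by
    rw [← Matrix.mulVec_mulVec, Matrix.dotProduct_mulVec, Matrix.vecMul_transpose]
    simp [dotProduct, sq]
  have hiso : ∀ n, S.Isolated a (C n) → ((S.design C) *ᵥ u) (n, S.support (C n) a) = u a := by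
    intro n hn
    rw [Matrix.mulVec, dotProduct, Finset.sum_eq_single a]
    · simp [S.design_apply]
    · intro b _ hb
      rw [S.design_apply, if_neg (fun h => hn b hb h.symm), zero_mul]
    · simp
  rw [hquad, Fintype.sum_prod_type]
  calc (S.isolatedCount C a : ℝ) * u a ^ 2
      = ∑ n ∈ Finset.univ.filter fun n => S.Isolated a (C n), u a ^ 2 := by
        rw [Finset.sum_const, nsmul_eq_mul, Signals.isolatedCount]
    _ ≤ ∑ n ∈ Finset.univ.filter fun n => S.Isolated a (C n),
          ∑ z, ((S.design C) *ᵥ u) (n, z) ^ 2 := by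
        refine Finset.sum_le_sum fun n hn => ?_
        rw [← hiso n (Finset.mem_filter.mp hn).2]
        exact Finset.single_le_sum (f := fun z => ((S.design C) *ᵥ u) (n, z) ^ 2)
          (fun z _ => sq_nonneg _) (Finset.mem_univ _)
    _ ≤ _ := Finset.sum_le_sum_of_subset_of_nonneg (Finset.filter_subset _ _)
        fun n _ _ => Finset.sum_nonneg fun z _ => sq_nonneg _

theorem Signals.isUnit_det_gram (S : Signals N T kc k) (C : Fin nc → Fin T → Clifford N)
    (h : ∀ a, 0 < S.isolatedCount C a) : IsUnit ((S.design C)ᵀ * S.design C).det := by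
  rw [← Matrix.isUnit_iff_isUnit_det, ← Matrix.mulVec_injective_iff_isUnit]
  intro u v huv
  rw [← sub_eq_zero]
  funext a
  have h1 : ((S.design C)ᵀ * S.design C) *ᵥ (u - v) = 0 := by
    rw [Matrix.mulVec_sub, sub_eq_zero]; exact huv
  have h2 := S.isolatedCount_mul_sq_le C a (u - v)
  rw [h1, dotProduct_zero] at h2
  have h3 : (0 : ℝ) < S.isolatedCount C a := Nat.cast_pos.mpr (h a)
  have h4 : (u - v) a ^ 2 ≤ 0 := by
    by_contra h5
    exact absurd h2 (not_le.mpr (mul_pos h3 (not_le.mp h5)))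
  exact pow_eq_zero_iff (two_ne_zero) |>.mp (le_antisymm h4 (sq_nonneg _))

theorem Signals.sum_sq_pinv_le (S : Signals N T kc k) (C : Fin nc → Fin T → Clifford N)
    (a : Option (Fin k × Fin T)) (hdet : IsUnit ((S.design C)ᵀ * S.design C).det)
    (h : nc ≤ 16 * S.isolatedCount C a) :
    nc * ∑ r, ((((S.design C)ᵀ * S.design C)⁻¹ * (S.design C)ᵀ) a r) ^ 2 ≤ 16 := by
  set G := (S.design C)ᵀ * S.design C with hG
  have hGT : Gᵀ = G := by rw [hG, Matrix.transpose_mul, Matrix.transpose_transpose]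
  have hdiag : ∑ r, ((G⁻¹ * (S.design C)ᵀ) a r) ^ 2 = G⁻¹ a a := by
    calc ∑ r, ((G⁻¹ * (S.design C)ᵀ) a r) ^ 2
        = ((G⁻¹ * (S.design C)ᵀ) * (G⁻¹ * (S.design C)ᵀ)ᵀ) a a := by
          simp only [Matrix.mul_apply (M := G⁻¹ * (S.design C)ᵀ), Matrix.transpose_apply, sq]
      _ = G⁻¹ a a := by
          rw [Matrix.transpose_mul, Matrix.transpose_transpose, Matrix.transpose_nonsing_inv, hGT,
            Matrix.mul_assoc, ← Matrix.mul_assoc (S.design C)ᵀ, ← hG,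
            Matrix.mul_nonsing_inv _ hdet, Matrix.mul_one]
  -- Testing the quadratic form on $u=G^{-1}e_a$ gives $\#\cdot(G^{-1}_{aa})^2\le G^{-1}_{aa}$,
  -- where $\#$ counts the circuits isolating $a$.
  have hkey := S.isolatedCount_mul_sq_le C a (G⁻¹ *ᵥ Pi.single a 1)
  rw [← hG, Matrix.mulVec_mulVec, Matrix.mul_nonsing_inv _ hdet, Matrix.one_mulVec,
    dotProduct_single, mul_one, Matrix.mulVec_single_one, Matrix.col_apply] at hkey
  rw [hdiag]
  have hnn : 0 ≤ G⁻¹ a a := by rw [← hdiag]; exact Finset.sum_nonneg fun r _ => sq_nonneg _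
  have hnc : (nc : ℝ) ≤ 16 * S.isolatedCount C a := by exact_mod_cast h
  rcases hnn.eq_or_lt with h0 | hpos
  · rw [← h0]; norm_num
  · have h1 : (S.isolatedCount C a : ℝ) * G⁻¹ a a ≤ 1 := by
      refine le_of_mul_le_mul_right ?_ hpos
      linarith
    nlinarith

/-! ### The outcome probabilities form a distribution. -/

section
open scoped ComplexOrder

/-- Density matrices. -/
def IsState (ρ : Op N) : Prop := ρ.PosSemidef ∧ ρ.trace = 1

theorem IsState.conj {ρ U : Op N} (h : IsState ρ) (hU : Uᴴ * U = 1) : IsState (U * ρ * Uᴴ) := by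
  refine ⟨h.1.mul_mul_conjTranspose_same U, ?_⟩
  rw [Matrix.mul_assoc, Matrix.trace_mul_comm, Matrix.mul_assoc, hU, mul_one, h.2]

theorem IsState.pauliChannel {ρ : Op N} (h : IsState ρ) {g : ℝ} (hg : g ∈ Set.Icc (0 : ℝ) 1)
    (P : PauliString N) : IsState (pauliChannel g P ρ) := by
  have hP : IsState (pauliOp P * ρ * pauliOp P) := by
    have := h.conj (U := pauliOp P) (by rw [conjTranspose_pauliOp, pauliOp_mul_self])
    rwa [conjTranspose_pauliOp] at this
  refine ⟨(h.1.smul ?_).add (hP.1.smul ?_), ?_⟩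
  · exact Complex.zero_le_real.mpr (sub_nonneg.mpr hg.2)
  · exact Complex.zero_le_real.mpr hg.1
  · rw [CliffordSensing.pauliChannel, Matrix.trace_add, Matrix.trace_smul, Matrix.trace_smul, h.2,
      hP.2]
    push_cast
    simp

theorem isState_zero : IsState (Matrix.single 0 0 1 : Op N) := by
  constructor
  · have h : (Matrix.single 0 0 1 : Op N) = Matrix.diagonal (Pi.single 0 1) := by
      rw [Matrix.diagonal_single]
    rw [h, Matrix.posSemidef_diagonal_iff]
    intro i
    by_cases hi : i = 0
    · subst hi; simp
    · simp [hi]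
  · simp

/-- The exponent is skew-Hermitian, being $-i$ times a real combination of Hermitian strings. -/
theorem Signals.cohOp_unitary (S : Signals N T kc k) (t : Fin T) :
    (S.cohOp t)ᴴ * S.cohOp t = 1 := by
  set H : Op N := ∑ α, (S.θ α t : ℂ) • pauliOp (S.cohPauli α) with hH
  have hherm : Hᴴ = H := by
    simp [hH, Matrix.conjTranspose_sum, Matrix.conjTranspose_smul, conjTranspose_pauliOp]
  have hconj : (-Complex.I • H)ᴴ = -(-Complex.I • H) := by
    simp [Matrix.conjTranspose_smul, hherm]
  rw [Signals.cohOp, ← hH, ← Matrix.exp_conjTranspose, hconj,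
    ← Matrix.exp_add_of_commute _ _ (Commute.refl (-Complex.I • H)).neg_left, neg_add_cancel,
    NormedSpace.exp_zero]

theorem Signals.isState_layer (S : Signals N T kc k) (hγ : ∀ β t, S.γ β t ∈ Set.Icc (0 : ℝ) 1)
    (t : Fin T) {ρ : Op N} (h : IsState ρ) : IsState (S.layer t ρ) := by
  rw [Signals.layer]
  generalize List.finRange k = l
  have h0 := h.conj (S.cohOp_unitary t)
  induction l using List.reverseRecOn with
  | nil => exact h0
  | append_singleton l β ih =>
    rw [List.foldl_append]
    exact ih.pauliChannel (hγ β t) _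

theorem Signals.isState_finalState (S : Signals N T kc k)
    (hγ : ∀ β t, S.γ β t ∈ Set.Icc (0 : ℝ) 1) (C : Fin T → Clifford N) :
    IsState (S.finalState C) := by
  have hfold : ∀ l : List (Fin T), IsState
      (l.foldl (fun ρ t => S.layer t ((C t).toOp * ρ * ((C t).toOp)ᴴ)) (Matrix.single 0 0 1)) := by
    intro l
    induction l using List.reverseRecOn with
    | nil => exact isState_zero
    | append_singleton l t ih =>
      rw [List.foldl_append]
      exact S.isState_layer hγ t (ih.conj (star_opOf_mul_self (C t).out))
  have h := (hfold (List.finRange T)).conj (U := (partialCircuit C T)ᴴ) (by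
    rw [Matrix.conjTranspose_conjTranspose, ← opOf_prefixProd]
    exact opOf_mul_star_self _)
  rwa [Matrix.conjTranspose_conjTranspose] at h

theorem Signals.outcomeProb_nonneg (S : Signals N T kc k)
    (hγ : ∀ β t, S.γ β t ∈ Set.Icc (0 : ℝ) 1) (C : Fin T → Clifford N) (z : Bitstring N) :
    0 ≤ S.outcomeProb C z :=
  (Complex.nonneg_iff.mp ((S.isState_finalState hγ C).1.diag_nonneg (i := z))).1

theorem Signals.sum_outcomeProb (S : Signals N T kc k)
    (hγ : ∀ β t, S.γ β t ∈ Set.Icc (0 : ℝ) 1) (C : Fin T → Clifford N) :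
    ∑ z, S.outcomeProb C z = 1 := by
  have h := congrArg Complex.re (S.isState_finalState hγ C).2
  rw [Matrix.trace, Complex.re_sum] at h
  exact h

end

/-! ### Concentration of linear functionals of the empirical frequencies. -/

/-- The probability of the outcomes `z` when `m` independent samples are drawn from each of the
distributions `p n`. -/
def shotProb (p : Fin nc → Bitstring N → ℝ) (z : Fin nc → Fin m → Bitstring N) : ℝ :=
  ∏ n, ∏ j, p n (z n j)

theorem sum_prod_shots (F : Fin nc → Bitstring N → ℝ) :
    ∑ z : Fin nc → Fin m → Bitstring N, ∏ n, ∏ j, F n (z n j) = ∏ n, (∑ w, F n w) ^ m := by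
  have h : ∀ n, (∑ w, F n w) ^ m = ∑ x : Fin m → Bitstring N, ∏ j, F n (x j) := by
    intro n
    rw [Fintype.sum_pow (fun w => F n w) m]
  simp only [h]
  rw [Finset.prod_univ_sum, Fintype.piFinset_univ]

theorem shotProb_nonneg {p : Fin nc → Bitstring N → ℝ} (hp : ∀ n w, 0 ≤ p n w)
    (z : Fin nc → Fin m → Bitstring N) : 0 ≤ shotProb p z :=
  Finset.prod_nonneg fun n _ => Finset.prod_nonneg fun _ _ => hp n _

theorem sum_shotProb {p : Fin nc → Bitstring N → ℝ} (hp1 : ∀ n, ∑ w, p n w = 1) :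
    ∑ z : Fin nc → Fin m → Bitstring N, shotProb p z = 1 := by
  unfold shotProb
  rw [sum_prod_shots]
  simp [hp1]

theorem sum_mul_empirical (y : Fin nc × Bitstring N → ℝ) (z : Fin nc → Fin m → Bitstring N) :
    ∑ r, y r * empirical z r = (∑ n, ∑ j, y (n, z n j)) / m := by
  rw [Fintype.sum_prod_type, Finset.sum_div]
  refine Finset.sum_congr rfl fun n _ => ?_
  have h : ∀ w, y (n, w) * empirical z (n, w)
      = (∑ j, if z n j = w then y (n, w) else 0) / m := by
    intro w
    rw [empirical, mul_div_assoc', ← Finset.sum_filter, Finset.sum_const, nsmul_eq_mul, mul_comm]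
  simp only [h]
  rw [← Finset.sum_div, Finset.sum_comm]
  simp

theorem empirical_mem_Icc (z : Fin nc → Fin m → Bitstring N) (r : Fin nc × Bitstring N) :
    empirical z r ∈ Set.Icc (0 : ℝ) 1 := by
  refine ⟨by unfold empirical; positivity, div_le_one_of_le₀ ?_ (Nat.cast_nonneg _)⟩
  exact_mod_cast (Finset.card_le_univ _).trans_eq (Fintype.card_fin m)

/-- The moment generating function of one bounded observation. -/
theorem sum_mul_exp_le {Ω : Type*} [Fintype Ω] {q f : Ω → ℝ} (hq : ∀ w, 0 ≤ q w)
    (hq1 : ∑ w, q w = 1) (hf : ∀ w, |f w| ≤ 1) :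
    ∑ w, q w * Real.exp (f w) ≤ Real.exp (∑ w, q w * f w + ∑ w, f w ^ 2) := by
  -- Bounding $q\le1$ replaces the second moment by the unweighted $\sum f^2$, the quantity
  -- controlled by the pseudo-inverse.
  have hle1 : ∀ w, q w ≤ 1 := fun w =>
    hq1 ▸ Finset.single_le_sum (fun i _ => hq i) (Finset.mem_univ w)
  calc ∑ w, q w * Real.exp (f w) ≤ ∑ w, (q w + q w * f w + f w ^ 2) := by
        refine Finset.sum_le_sum fun w _ => ?_
        have h := (abs_le.mp (Real.abs_exp_sub_one_sub_id_le (hf w))).2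
        have h2 : q w * Real.exp (f w) ≤ q w * (1 + f w + f w ^ 2) :=
          mul_le_mul_of_nonneg_left (by linarith) (hq w)
        nlinarith [mul_le_mul_of_nonneg_right (hle1 w) (sq_nonneg (f w))]
    _ = (∑ w, q w * f w + ∑ w, f w ^ 2) + 1 := by
        rw [Finset.sum_add_distrib, Finset.sum_add_distrib, hq1]; ring
    _ ≤ _ := Real.add_one_le_exp _

theorem sum_shotProb_mul_exp_le {p : Fin nc → Bitstring N → ℝ} (hp : ∀ n w, 0 ≤ p n w)
    (hp1 : ∀ n, ∑ w, p n w = 1) (y : Fin nc × Bitstring N → ℝ) {s : ℝ}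
    (hs : ∀ r, |s * y r| ≤ 1) (hm : 0 < m) :
    ∑ z : Fin nc → Fin m → Bitstring N, shotProb p z *
        Real.exp (s * m * ∑ r, y r * (empirical z r - p r.1 r.2))
      ≤ Real.exp (s ^ 2 * m * ∑ r, y r ^ 2) := by
  have hm' : (m : ℝ) ≠ 0 := Nat.cast_ne_zero.mpr hm.ne'
  have hterm : ∀ z : Fin nc → Fin m → Bitstring N, shotProb p z *
      Real.exp (s * m * ∑ r, y r * (empirical z r - p r.1 r.2))
        = Real.exp (-(s * m * ∑ r, y r * p r.1 r.2)) *
          ∏ n, ∏ j, p n (z n j) * Real.exp (s * y (n, z n j)) := by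
    intro z
    have h : s * m * ∑ r, y r * (empirical z r - p r.1 r.2)
        = -(s * m * ∑ r, y r * p r.1 r.2) + ∑ n, ∑ j, s * y (n, z n j) := by
      simp only [mul_sub, Finset.sum_sub_distrib]
      rw [sum_mul_empirical]
      simp only [← Finset.mul_sum]
      field_simp
      ring
    rw [h, Real.exp_add]
    simp only [Finset.prod_mul_distrib, ← Real.exp_sum, shotProb]
    ring
  simp only [hterm]
  rw [← Finset.mul_sum, sum_prod_shots (fun n w => p n w * Real.exp (s * y (n, w)))]
  calc _ ≤ Real.exp (-(s * m * ∑ r, y r * p r.1 r.2)) * ∏ n, Real.exp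
        (∑ w, p n w * (s * y (n, w)) + ∑ w, (s * y (n, w)) ^ 2) ^ m := by
        refine mul_le_mul_of_nonneg_left ?_ (Real.exp_nonneg _)
        have hnn : ∀ n, 0 ≤ ∑ w, p n w * Real.exp (s * y (n, w)) := fun n =>
          Finset.sum_nonneg fun w _ => mul_nonneg (hp n w) (Real.exp_nonneg _)
        exact Finset.prod_le_prod (fun n _ => pow_nonneg (hnn n) m) fun n _ =>
          pow_le_pow_left₀ (hnn n) (sum_mul_exp_le (hp n) (hp1 n) fun w => hs (n, w)) m
    _ = _ := by
        simp only [← Real.exp_nat_mul, ← Real.exp_sum, ← Real.exp_add]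
        congr 1
        rw [Fintype.sum_prod_type, Fintype.sum_prod_type]
        simp only [Finset.mul_sum, mul_add, Finset.sum_add_distrib, ← Finset.sum_neg_distrib]
        rw [← add_assoc, ← Finset.sum_add_distrib]
        have h0 : ∀ n, (∑ w, -(s * m * (y (n, w) * p n w)) + ∑ w, m * (p n w * (s * y (n, w))))
            = 0 := by
          intro n
          rw [← Finset.sum_add_distrib]
          exact Finset.sum_eq_zero fun w _ => by ring
        simp only [Finset.sum_neg_distrib] at h0 ⊢
        simp only [h0, Finset.sum_const_zero, zero_add]
        exact Finset.sum_congr rfl fun n _ => Finset.sum_congr rfl fun w _ => by ring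

theorem prob_lt_sum_le {p : Fin nc → Bitstring N → ℝ} (hp : ∀ n w, 0 ≤ p n w)
    (hp1 : ∀ n, ∑ w, p n w = 1) (y : Fin nc × Bitstring N → ℝ) {η : ℝ} (hη : 0 < η)
    (hnc : 0 < nc) (hm : 0 < m) (hy : ∀ r, |y r| ≤ 32 / (nc * η))
    (hy2 : nc * ∑ r, y r ^ 2 ≤ 16) :
    (∑ z : Fin nc → Fin m → Bitstring N,
        if η / 2 < ∑ r, y r * (empirical z r - p r.1 r.2) then shotProb p z else 0)
      ≤ Real.exp (-((nc * m : ℕ) * η ^ 2 / 256)) := by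
  have hnc' : (0 : ℝ) < nc := Nat.cast_pos.mpr hnc
  have hm' : (0 : ℝ) < m := Nat.cast_pos.mpr hm
  -- With this tilt $|sy|\le\tfrac12$, the gain is $M\eta^2/128$ and the variance term at most
  -- $M\eta^2/256$.
  set s : ℝ := nc * η / 64 with hsdef
  have hs0 : 0 < s := by positivity
  have hs : ∀ r, |s * y r| ≤ 1 := by
    intro r
    rw [abs_mul, abs_of_pos hs0]
    calc s * |y r| ≤ s * (32 / (nc * η)) := mul_le_mul_of_nonneg_left (hy r) hs0.le
      _ = 1 / 2 := by rw [hsdef]; field_simp; norm_num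
      _ ≤ 1 := by norm_num
  calc _ ≤ ∑ z : Fin nc → Fin m → Bitstring N, Real.exp (-(s * m * (η / 2))) * (shotProb p z *
          Real.exp (s * m * ∑ r, y r * (empirical z r - p r.1 r.2))) := by
        refine Finset.sum_le_sum fun z _ => ?_
        have hw := shotProb_nonneg hp z
        split_ifs with h
        · rw [mul_left_comm, ← Real.exp_add]
          refine le_mul_of_one_le_right hw (Real.one_le_exp ?_)
          have := mul_lt_mul_of_pos_left h (mul_pos hs0 hm')
          linarith
        · positivity
    _ ≤ Real.exp (-(s * m * (η / 2))) * Real.exp (s ^ 2 * m * ∑ r, y r ^ 2) := by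
        rw [← Finset.mul_sum]
        exact mul_le_mul_of_nonneg_left (sum_shotProb_mul_exp_le hp hp1 y hs hm)
          (Real.exp_nonneg _)
    _ ≤ _ := by
        rw [← Real.exp_add]
        refine Real.exp_le_exp.mpr ?_
        have h1 : s ^ 2 * m * ∑ r, y r ^ 2 = nc * η ^ 2 * m / 4096 * (nc * ∑ r, y r ^ 2) := by
          rw [hsdef]; ring
        have h2 : nc * η ^ 2 * m / 4096 * (nc * ∑ r, y r ^ 2) ≤ nc * η ^ 2 * m / 4096 * 16 :=
          mul_le_mul_of_nonneg_left hy2 (by positivity)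
        rw [h1, hsdef]
        push_cast
        linarith

/-- Concentration of a linear functional of the empirical frequencies around its mean. -/
theorem prob_lt_abs_sum_le {p : Fin nc → Bitstring N → ℝ} (hp : ∀ n w, 0 ≤ p n w)
    (hp1 : ∀ n, ∑ w, p n w = 1) (y : Fin nc × Bitstring N → ℝ) {η : ℝ} (hη : 0 < η)
    (hnc : 0 < nc) (hm : 0 < m) (hy2 : nc * ∑ r, y r ^ 2 ≤ 16) :
    (∑ z : Fin nc → Fin m → Bitstring N,
        if η < |∑ r, y r * (empirical z r - p r.1 r.2)| then shotProb p z else 0)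
      ≤ 2 * Real.exp (-((nc * m : ℕ) * η ^ 2 / 256)) := by
  have hnc' : (0 : ℝ) < nc := Nat.cast_pos.mpr hnc
  -- The $\ell^2$ bound alone does not give the sup bound needed for the tilt, so entries above $B$
  -- are cut off. They contribute at most $\sum y^2/B\le\eta/2$, deterministically.
  set B : ℝ := 32 / (nc * η) with hB
  have hB0 : 0 < B := by positivity
  let y1 : Fin nc × Bitstring N → ℝ := fun r => if |y r| ≤ B then y r else 0
  have hy1 : ∀ r, |y1 r| ≤ B := by
    intro r
    simp only [y1]
    split_ifs with h
    · exact h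
    · simpa using hB0.le
  have hy1sq : nc * ∑ r, y1 r ^ 2 ≤ 16 := by
    refine le_trans (mul_le_mul_of_nonneg_left (Finset.sum_le_sum fun r _ => ?_) hnc'.le) hy2
    simp only [y1]
    split_ifs
    · exact le_rfl
    · rw [zero_pow two_ne_zero]; exact sq_nonneg _
  have hp_le : ∀ n w, p n w ≤ 1 := fun n w =>
    hp1 n ▸ Finset.single_le_sum (fun i _ => hp n i) (Finset.mem_univ w)
  have htail : ∀ z : Fin nc → Fin m → Bitstring N,
      |∑ r, y r * (empirical z r - p r.1 r.2) - ∑ r, y1 r * (empirical z r - p r.1 r.2)|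
        ≤ η / 2 := by
    intro z
    rw [← Finset.sum_sub_distrib]
    calc _ ≤ ∑ r, |y r * (empirical z r - p r.1 r.2) - y1 r * (empirical z r - p r.1 r.2)| :=
          Finset.abs_sum_le_sum_abs _ _
      _ ≤ ∑ r, y r ^ 2 / B := by
          refine Finset.sum_le_sum fun r _ => ?_
          rw [← sub_mul, abs_mul]
          have hd : |empirical z r - p r.1 r.2| ≤ 1 := by
            have h1 := empirical_mem_Icc z r
            rw [abs_le]
            constructor <;> linarith [h1.1, h1.2, hp r.1 r.2, hp_le r.1 r.2]
          have hd2 : |y r - y1 r| ≤ y r ^ 2 / B := by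
            simp only [y1]
            split_ifs with h
            · rw [sub_self, abs_zero]; positivity
            · rw [sub_zero, le_div_iff₀ hB0, ← sq_abs, sq]
              exact mul_le_mul_of_nonneg_left (not_le.mp h).le (abs_nonneg _)
          calc _ ≤ |y r - y1 r| * 1 := mul_le_mul_of_nonneg_left hd (abs_nonneg _)
            _ ≤ _ := by rwa [mul_one]
      _ = η / 32 * (nc * ∑ r, y r ^ 2) := by
          rw [← Finset.sum_div, hB]
          field_simp
      _ ≤ η / 32 * 16 := mul_le_mul_of_nonneg_left hy2 (by positivity)
      _ = _ := by ring
  have h1 := prob_lt_sum_le (m := m) hp hp1 y1 hη hnc hm hy1 hy1sq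
  have h2 := prob_lt_sum_le (m := m) hp hp1 (fun r => -y1 r) hη hnc hm
    (fun r => by rw [abs_neg]; exact hy1 r) (by simpa only [neg_sq] using hy1sq)
  rw [two_mul]
  refine le_trans ?_ (add_le_add h1 h2)
  rw [← Finset.sum_add_distrib]
  refine Finset.sum_le_sum fun z _ => ?_
  have hw := shotProb_nonneg hp z
  have ht := abs_le.mp (htail z)
  simp only [neg_mul, Finset.sum_neg_distrib]
  split_ifs with ha hb hc hc <;> try linarith
  exfalso
  rcases lt_abs.mp ha with h | h <;> linarith

/-! ### Stability of the rate estimator. -/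

theorem prod_le_of_mem_Icc {ι : Type*} [Fintype ι] [DecidableEq ι] {f : ι → ℝ}
    (hf : ∀ i, f i ∈ Set.Icc (0 : ℝ) 1) (i : ι) : ∏ j, f j ≤ f i := by
  rw [← Finset.mul_prod_erase _ _ (Finset.mem_univ i)]
  exact mul_le_of_le_one_right (hf i).1
    (Finset.prod_le_one (fun j _ => (hf j).1) fun j _ => (hf j).2)

theorem prod_mem_Icc {ι : Type*} [Fintype ι] {f : ι → ℝ}
    (hf : ∀ i, f i ∈ Set.Icc (0 : ℝ) 1) : ∏ j, f j ∈ Set.Icc (0 : ℝ) 1 :=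
  ⟨Finset.prod_nonneg fun j _ => (hf j).1,
    Finset.prod_le_one (fun j _ => (hf j).1) fun j _ => (hf j).2⟩

/-- With $A>0$ this keeps $\gamma$ away from 1 and gives $A\gamma/(1-\gamma)\le1$. -/
theorem Signals.fidelity_le (S : Signals N T kc k) (hγ : ∀ β t, S.γ β t ∈ Set.Icc (0 : ℝ) 1)
    (β : Fin k) (t : Fin T) : S.fidelity ≤ 1 - S.γ β t := by
  have h1 : ∀ β t, 1 - S.γ β t ∈ Set.Icc (0 : ℝ) 1 := fun β t =>
    ⟨by linarith [(hγ β t).2], by linarith [(hγ β t).1]⟩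
  have hcos : ∏ α, ∏ t, Real.cos (S.θ α t) ^ 2 ∈ Set.Icc (0 : ℝ) 1 :=
    prod_mem_Icc fun α => prod_mem_Icc fun t => ⟨sq_nonneg _, Real.cos_sq_le_one _⟩
  have hprod := prod_mem_Icc fun β => prod_mem_Icc fun t => h1 β t
  calc S.fidelity ≤ ∏ β, ∏ t, (1 - S.γ β t) := mul_le_of_le_one_left hprod.1 hcos.2
    _ ≤ ∏ t, (1 - S.γ β t) := prod_le_of_mem_Icc (fun β => prod_mem_Icc fun t => h1 β t) β
    _ ≤ 1 - S.γ β t := prod_le_of_mem_Icc (fun t => h1 β t) t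

theorem Signals.coeff_sub (S : Signals N T kc k) (C : Fin nc → Fin T → Clifford N)
    (f g : Fin nc × Bitstring N → ℝ) (a : Option (Fin k × Fin T)) :
    S.coeff C f a - S.coeff C g a
      = ∑ r, (((S.design C)ᵀ * S.design C)⁻¹ * (S.design C)ᵀ) a r * (f r - g r) := by
  simp only [Signals.coeff, Matrix.mulVec, dotProduct, mul_sub, Finset.sum_sub_distrib]

/-- Stability of the ratio `v / (v + v₀)`. -/
theorem abs_ratio_sub_le {a A g v v₀ w w₀ ε : ℝ} (ha : 0 < a) (haA : a ≤ A) (hA : A ≤ 1 - g)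
    (hg0 : 0 ≤ g) (hε : 0 < ε) (hε1 : ε ≤ 1) (hv₀ : |v₀ - A| ≤ A / 4)
    (hv : |v - A * (g / (1 - g))| ≤ A / 4) (hw : |w - v| ≤ a ^ 2 * ε / 20)
    (hw₀ : |w₀ - v₀| ≤ a ^ 2 * ε / 20) : |w / (w + w₀) - v / (v + v₀)| ≤ ε := by
  have hA0 : 0 < A := by linarith
  have hg1 : 0 < 1 - g := by linarith
  set x := A * (g / (1 - g)) with hx
  have hx0 : 0 ≤ x := by positivity
  have hx1 : x ≤ 1 := by
    rw [hx, mul_div_assoc', div_le_one hg1]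
    nlinarith
  set η := a ^ 2 * ε / 20 with hη
  have hη0 : 0 < η := by positivity
  have hηA : η ≤ A ^ 2 * ε / 20 := by rw [hη]; gcongr
  have hA2 : A ^ 2 * ε ≤ A := by
    have : A * (A * ε) ≤ A * 1 := mul_le_mul_of_nonneg_left (by nlinarith) hA0.le
    nlinarith
  obtain ⟨h1, h2⟩ := abs_le.mp hv₀
  obtain ⟨h3, h4⟩ := abs_le.mp hv
  obtain ⟨h5, h6⟩ := abs_le.mp hw
  obtain ⟨h7, h8⟩ := abs_le.mp hw₀
  have hden : A / 2 ≤ v + v₀ := by linarith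
  have hden' : A / 4 ≤ w + w₀ := by linarith
  have hd0 : 0 < v + v₀ := by linarith
  have hd0' : 0 < w + w₀ := by linarith
  have heq : w / (w + w₀) - v / (v + v₀)
      = ((w - v) * v₀ - v * (w₀ - v₀)) / ((w + w₀) * (v + v₀)) := by
    field_simp
    ring
  have hv₀abs : |v₀| ≤ 5 / 4 := abs_le.mpr ⟨by linarith, by linarith⟩
  have hvabs : |v| ≤ 5 / 4 := abs_le.mpr ⟨by linarith, by linarith⟩
  have hnum : |(w - v) * v₀ - v * (w₀ - v₀)| ≤ η * (5 / 2) := by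
    calc _ ≤ |(w - v) * v₀| + |v * (w₀ - v₀)| := abs_sub _ _
      _ = |w - v| * |v₀| + |v| * |w₀ - v₀| := by rw [abs_mul, abs_mul]
      _ ≤ η * (5 / 4) + 5 / 4 * η := by gcongr
      _ = _ := by ring
  rw [heq, abs_div, abs_of_pos (mul_pos hd0' hd0), div_le_iff₀ (mul_pos hd0' hd0)]
  -- The constant $20$ in the tolerance is chosen so that
  -- $\tfrac52\cdot\tfrac1{20}=\tfrac14\cdot\tfrac12$.
  have hdd : A / 4 * (A / 2) ≤ (w + w₀) * (v + v₀) := by gcongr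
  calc _ ≤ η * (5 / 2) := hnum
    _ ≤ A ^ 2 * ε / 20 * (5 / 2) := by gcongr
    _ = ε * (A / 4 * (A / 2)) := by ring
    _ ≤ _ := mul_le_mul_of_nonneg_left hdd hε.le

/-! ### Failure probability over shots and circuits. -/

open Classical in
/-- When every column is isolated in many circuits, the least-squares coefficients are close to
their means with high probability over the measurement outcomes. -/
theorem Signals.prob_exists_coeff_far_le (S : Signals N T kc k)
    (hγ : ∀ β t, S.γ β t ∈ Set.Icc (0 : ℝ) 1) (C : Fin nc → Fin T → Clifford N)
    (hC : ∀ a, nc ≤ 16 * S.isolatedCount C a) {η : ℝ} (hη : 0 < η) (hnc : 0 < nc) (hm : 0 < m)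
    (hdet : IsUnit ((S.design C)ᵀ * S.design C).det) :
    (∑ z : Fin nc → Fin m → Bitstring N,
        if ∃ a, η < |S.coeff C (empirical z) a - S.coeff C (S.exact C) a|
          then shotProb (fun n => S.outcomeProb (C n)) z else 0)
      ≤ 2 * ((k * T : ℕ) + 1) * Real.exp (-((nc * m : ℕ) * η ^ 2 / 256)) := by
  set p : Fin nc → Bitstring N → ℝ := fun n => S.outcomeProb (C n) with hpdef
  have hp : ∀ n w, 0 ≤ p n w := fun n w => S.outcomeProb_nonneg hγ (C n) w
  have hp1 : ∀ n, ∑ w, p n w = 1 := fun n => S.sum_outcomeProb hγ (C n)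
  have hone : ∀ a, (∑ z : Fin nc → Fin m → Bitstring N,
      if η < |S.coeff C (empirical z) a - S.coeff C (S.exact C) a| then shotProb p z else 0)
        ≤ 2 * Real.exp (-((nc * m : ℕ) * η ^ 2 / 256)) := by
    intro a
    simp only [S.coeff_sub]
    exact prob_lt_abs_sum_le hp hp1 _ hη hnc hm (S.sum_sq_pinv_le C a hdet (hC a))
  calc _ ≤ ∑ z : Fin nc → Fin m → Bitstring N, ∑ a,
        (if η < |S.coeff C (empirical z) a - S.coeff C (S.exact C) a|
          then shotProb p z else 0) := by
        refine Finset.sum_le_sum fun z _ => ?_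
        have hw := shotProb_nonneg hp z
        have hnn : ∀ a, 0 ≤ (if η < |S.coeff C (empirical z) a - S.coeff C (S.exact C) a|
            then shotProb p z else 0) := by
          intro a; split_ifs <;> [exact hw; exact le_rfl]
        split_ifs with h
        · obtain ⟨a, ha⟩ := h
          refine le_trans ?_ (Finset.single_le_sum (fun a _ => hnn a) (Finset.mem_univ a))
          rw [if_pos ha]
        · exact Finset.sum_nonneg fun a _ => hnn a
    _ = ∑ a, ∑ z : Fin nc → Fin m → Bitstring N,
        (if η < |S.coeff C (empirical z) a - S.coeff C (S.exact C) a|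
          then shotProb p z else 0) := Finset.sum_comm
    _ ≤ ∑ _a : Option (Fin k × Fin T), 2 * Real.exp (-((nc * m : ℕ) * η ^ 2 / 256)) :=
        Finset.sum_le_sum fun a _ => hone a
    _ = _ := by
        rw [Finset.sum_const, Finset.card_univ, nsmul_eq_mul]
        simp only [Fintype.card_option, Fintype.card_prod, Fintype.card_fin]
        push_cast
        ring

open Classical in
/-- An event that has conditional probability at least `1 - δ / 2` for all circuits outside a set
of measure at most `δ / 2` has probability at least `1 - δ`. -/
theorem Signals.le_prob_of_forall (S : Signals N T kc k)
    (hγ : ∀ β t, S.γ β t ∈ Set.Icc (0 : ℝ) 1)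
    (E : (Fin nc → Fin T → Clifford N) → (Fin nc → Fin m → Bitstring N) → Prop)
    (Bad : (Fin nc → Fin T → Clifford N) → Prop) [DecidablePred Bad] {δ : ℝ} (hδ1 : δ ≤ 1)
    (hBad : ((Finset.univ.filter Bad).card : ℝ)
      ≤ δ / 2 * Fintype.card (Fin nc → Fin T → Clifford N))
    (hE : ∀ C, ¬ Bad C → (∑ z, if ¬ E C z then shotProb (fun n => S.outcomeProb (C n)) z else 0)
      ≤ δ / 2) : 1 - δ ≤ S.prob E := by
  have hcard : (0 : ℝ) < Fintype.card (Fin nc → Fin T → Clifford N) :=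
    Nat.cast_pos.mpr Fintype.card_pos
  rw [Signals.prob, le_div_iff₀ hcard]
  set Z : ℝ := (Fintype.card (Fin nc → Fin T → Clifford N) : ℝ)
  have hcompl : ((Finset.univ.filter Bad).card : ℝ)
      + ((Finset.univ.filter fun C => ¬ Bad C).card : ℝ) = Z := by
    have := Finset.card_filter_add_card_filter_not (s := Finset.univ) Bad
    rw [← Nat.cast_add, this, Finset.card_univ]
  have hpos : ∀ C z, 0 ≤ (if E C z then ∏ n, ∏ j, S.outcomeProb (C n) (z n j) else 0) := by
    intro C z
    split_ifs
    · exact shotProb_nonneg (fun n w => S.outcomeProb_nonneg hγ (C n) w) z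
    · exact le_rfl
  have hgood : ∀ C, ¬ Bad C →
      1 - δ / 2 ≤ ∑ z, (if E C z then ∏ n, ∏ j, S.outcomeProb (C n) (z n j) else 0) := by
    intro C hC
    have h1 : ∑ z, shotProb (m := m) (fun n => S.outcomeProb (C n)) z = 1 :=
      sum_shotProb fun n => S.sum_outcomeProb hγ (C n)
    have h2 : ∑ z, shotProb (m := m) (fun n => S.outcomeProb (C n)) z
        = (∑ z, if E C z then shotProb (fun n => S.outcomeProb (C n)) z else 0)
          + ∑ z, if ¬ E C z then shotProb (fun n => S.outcomeProb (C n)) z else 0 := by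
      rw [← Finset.sum_add_distrib]
      refine Finset.sum_congr rfl fun z _ => ?_
      by_cases h : E C z <;> simp [h]
    have h3 := hE C hC
    change 1 - δ / 2 ≤ ∑ z, if E C z then shotProb (fun n => S.outcomeProb (C n)) z else 0
    linarith
  -- Good circuits and good outcomes each have probability at least $1-\delta/2$, and
  -- $(1-\delta/2)^2\ge1-\delta$.
  calc (1 - δ) * Z ≤ (1 - δ / 2) * ((1 - δ / 2) * Z) := by nlinarith [sq_nonneg δ]
    _ ≤ (1 - δ / 2) * ((Finset.univ.filter fun C => ¬ Bad C).card : ℝ) :=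
        mul_le_mul_of_nonneg_left (by linarith) (by linarith)
    _ = ∑ C ∈ Finset.univ.filter fun C => ¬ Bad C, (1 - δ / 2) := by
        rw [Finset.sum_const, nsmul_eq_mul, mul_comm]
    _ ≤ ∑ C ∈ Finset.univ.filter fun C => ¬ Bad C,
          ∑ z, (if E C z then ∏ n, ∏ j, S.outcomeProb (C n) (z n j) else 0) :=
        Finset.sum_le_sum fun C hC => hgood C (Finset.mem_filter.mp hC).2
    _ ≤ _ := Finset.sum_le_sum_of_subset_of_nonneg (Finset.filter_subset _ _)
        fun C _ _ => Finset.sum_nonneg fun z _ => hpos C z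

/-! ### Estimates for the sample and circuit bounds. -/

/-- With $y=\delta/K\le\tfrac12$ the exponential is at most $y^4\le y/8$, enough to absorb the two
tails of each of the $K+1$ columns. -/
theorem exp_failure_le {K : ℕ} (hK : 1 ≤ K) {δ x : ℝ} (hδ : 0 < δ) (hKδ : 2 * δ ≤ (K : ℝ))
    (hx : 4 * Real.log (K / δ) ≤ x) : 2 * ((K : ℝ) + 1) * Real.exp (-x) ≤ δ / 2 := by
  have hK1 : (1 : ℝ) ≤ K := Nat.one_le_cast.mpr hK
  have hK0 : (0 : ℝ) < K := by linarith
  set y : ℝ := δ / K with hy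
  have hy0 : 0 < y := by positivity
  have hy1 : y ≤ 1 / 2 := by rw [hy, div_le_iff₀ hK0]; linarith
  have hexp : Real.exp (-x) ≤ y ^ 4 := by
    rw [← Real.exp_log (pow_pos hy0 4), Real.log_pow]
    refine Real.exp_le_exp.mpr ?_
    have : Real.log (K / δ) = -Real.log y := by rw [hy, ← Real.log_inv, inv_div]
    push_cast
    linarith
  have hy4 : y ^ 4 ≤ y / 8 := by
    have h3 : y ^ 3 ≤ (1 / 2) ^ 3 := pow_le_pow_left₀ hy0.le hy1 3
    calc y ^ 4 = y * y ^ 3 := by ring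
      _ ≤ y * (1 / 2) ^ 3 := mul_le_mul_of_nonneg_left h3 hy0.le
      _ = _ := by ring
  have hyK : y * K = δ := by rw [hy]; field_simp
  calc 2 * ((K : ℝ) + 1) * Real.exp (-x) ≤ 2 * (K + 1) * (y / 8) := by
        gcongr; exact hexp.trans hy4
    _ ≤ 2 * (K + K) * (y / 8) := by gcongr
    _ = δ / 2 := by rw [← hyK]; ring

theorem log_sq_div_le {K : ℕ} (hK : 1 ≤ K) {δ : ℝ} (hδ : 0 < δ) (hδ1 : δ < 1) :
    Real.log (K ^ 2 / δ) ≤ 2 * Real.log (K / δ) := by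
  have hK1 : (1 : ℝ) ≤ K := Nat.one_le_cast.mpr hK
  have h : Real.log ((K / δ) ^ 2) = 2 * Real.log (K / δ) := by rw [Real.log_pow]; norm_num
  rw [← h, div_pow]
  refine Real.log_le_log (by positivity) ?_
  gcongr
  nlinarith

theorem log_two_le_log_div {K : ℕ} {δ : ℝ} (hδ : 0 < δ) (hKδ : 2 * δ ≤ (K : ℝ)) :
    Real.log 2 ≤ Real.log (K / δ) :=
  Real.log_le_log (by norm_num) (by rw [le_div_iff₀ hδ]; exact hKδ)

theorem log_div_le_sampleBound {N K : ℕ} {ε δ : ℝ} (hε : 0 < ε) (hε1 : ε ≤ 1)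
    (hδ : 0 < δ) (hKδ : 2 * δ ≤ (K : ℝ)) : Real.log (K / δ) ≤ sampleBound N K ε δ := by
  have hL : 0 ≤ Real.log (K / δ) :=
    (Real.log_nonneg (by norm_num)).trans (log_two_le_log_div hδ hKδ)
  refine le_trans ?_ (le_max_left _ _)
  rw [le_div_iff₀ (by positivity)]
  exact mul_le_of_le_one_right hL (pow_le_one₀ hε.le hε1)

/-- The assumption $2K\le2^N$ keeps the denominator at least $\log2>\tfrac12$. -/
theorem circuitBound_pos_and_le {N K : ℕ} {δ : ℝ} (hK : 1 ≤ K) (hKN : 2 * K ≤ 2 ^ N)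
    (hδ : 0 < δ) (hδ1 : δ < 1) (hKδ : 2 * δ ≤ (K : ℝ)) :
    0 < circuitBound N K δ ∧ circuitBound N K δ ≤ 4 * Real.log (K / δ) := by
  have hK1 : (1 : ℝ) ≤ K := Nat.one_le_cast.mpr hK
  have hlog2 : 1 / 2 < Real.log 2 := by linarith [Real.log_two_gt_d9]
  have h1 : Real.log 2 ≤ Real.log (2 ^ N / K) := by
    refine Real.log_le_log (by norm_num) ?_
    rw [le_div_iff₀ (by linarith)]
    exact_mod_cast hKN
  have hL : Real.log 2 ≤ Real.log (K / δ) := log_two_le_log_div hδ hKδ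
  have h2 : Real.log (K / δ) ≤ Real.log (K ^ 2 / δ) := by
    refine Real.log_le_log (by positivity) ?_
    gcongr
    nlinarith
  refine ⟨div_pos (by linarith) (by linarith), ?_⟩
  rw [circuitBound, div_le_iff₀ (by linarith)]
  have h3 := log_sq_div_le hK hδ hδ1
  nlinarith

/-- Feasible numbers of circuits and shots with a total of the order of the sample bound. -/
theorem exists_circuits_shots {N K : ℕ} {ε δ c : ℝ} (hc : 0 < c) (hK : 1 ≤ K)
    (hKN : 2 * K ≤ 2 ^ N) (hε : 0 < ε) (hε1 : ε ≤ 1) (hδ : 0 < δ) (hδ1 : δ < 1)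
    (hKδ : 2 * δ ≤ (K : ℝ)) :
    ∃ nc m : ℕ, c * circuitBound N K δ ≤ nc ∧ c * sampleBound N K ε δ ≤ ((nc * m : ℕ) : ℝ) ∧
      ((nc * m : ℕ) : ℝ) ≤ (5 * c + 2) * sampleBound N K ε δ := by
  obtain ⟨hcb, hcb'⟩ := circuitBound_pos_and_le hK hKN hδ hδ1 hKδ
  have hf := log_div_le_sampleBound (N := N) hε hε1 hδ hKδ
  have hL := log_two_le_log_div hδ hKδ
  have hlog2 : 1 / 2 < Real.log 2 := by linarith [Real.log_two_gt_d9]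
  generalize circuitBound N K δ = b at *
  generalize sampleBound N K ε δ = f at *
  have hnc : (0 : ℝ) < ⌈c * b⌉₊ := Nat.cast_pos.mpr (Nat.ceil_pos.mpr (by positivity))
  have hnc' := Nat.ceil_lt_add_one (a := c * b) (by positivity)
  have hf0 : 0 < f := by linarith
  have hm' := Nat.ceil_lt_add_one (a := c * f / ⌈c * b⌉₊) (by positivity)
  have hm := Nat.le_ceil (c * f / ⌈c * b⌉₊)
  -- Rounding $m$ up costs at most one extra shot per circuit, that is $n_c\le cb+1\le4cf+2f$, where
  -- $1\le2f$ because $f\ge\log2$.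
  refine ⟨⌈c * b⌉₊, ⌈c * f / ⌈c * b⌉₊⌉₊, Nat.le_ceil _, ?_, ?_⟩
  · rw [Nat.cast_mul]
    rwa [div_le_iff₀' hnc] at hm
  · rw [Nat.cast_mul]
    generalize (⌈c * b⌉₊ : ℝ) = n at *
    calc n * (⌈c * f / n⌉₊ : ℝ) ≤ n * (c * f / n + 1) := mul_le_mul_of_nonneg_left hm'.le hnc.le
      _ = c * f + n := by field_simp
      _ ≤ c * f + (c * (4 * f) + 2 * f) := by
          have : c * b ≤ c * (4 * f) := mul_le_mul_of_nonneg_left (by linarith) hc.le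
          linarith
      _ = _ := by ring

/-- Since $K^2/\delta\le(K/\delta)^2$, the third term is at most $2\log(K/\delta)\log(1/\delta)/N$,
which the hypothesis bounds by the first. -/
theorem sampleBound_eq {N K : ℕ} {ε δ : ℝ} (hN : 1 ≤ N) (hK : 1 ≤ K) (hε : 0 < ε) (hε1 : ε ≤ 1)
    (hδ : 0 < δ) (hδ1 : δ < 1) (hKδ : 2 * δ ≤ (K : ℝ)) (h : 2 * ε ^ 2 * Real.log (1 / δ) ≤ N) :
    sampleBound N K ε δ = Real.log (K / δ) / ε ^ 2 := by
  have hN' : (0 : ℝ) < N := Nat.cast_pos.mpr hN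
  have hL : 0 ≤ Real.log (K / δ) :=
    (Real.log_nonneg (by norm_num)).trans (log_two_le_log_div hδ hKδ)
  refine max_eq_left (max_le ?_ ?_)
  · gcongr
    nlinarith
  · have hd : 0 ≤ Real.log (1 / δ) := Real.log_nonneg (by rw [le_div_iff₀ hδ]; linarith)
    rw [div_le_div_iff₀ hN' (by positivity)]
    calc Real.log (K ^ 2 / δ) * Real.log (1 / δ) * ε ^ 2
        ≤ 2 * Real.log (K / δ) * Real.log (1 / δ) * ε ^ 2 := by
          gcongr
          exact log_sq_div_le hK hδ hδ1
      _ = Real.log (K / δ) * (2 * ε ^ 2 * Real.log (1 / δ)) := by ring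
      _ ≤ _ := mul_le_mul_of_nonneg_left h hL

end CliffordSensing

/-! ### The main theorem. -/

open CliffordSensing in
theorem mainTheorem2 (a : ℝ) (ha : 0 < a) :
    ∃ C₁ C₂ : ℝ, 0 < C₁ ∧ 0 < C₂ ∧
      ∀ (N T kc k : ℕ) (S : CliffordSensing.Signals N T kc k) (ε δ : ℝ),
        1 ≤ N →
        Function.Injective S.incPauli →
        (∀ β, S.incPauli β ≠ 0) →
        (∀ β t, S.γ β t ∈ Set.Icc (0 : ℝ) 1) →
        a ≤ S.fidelity →
        2 * (k * T) ≤ 2 ^ N →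
        0 < ε → ε ≤ 1 → 0 < δ → δ < 1 → 2 * δ ≤ ((k * T : ℕ) : ℝ) →
        (∀ nc m : ℕ,
          C₁ * CliffordSensing.circuitBound N (k * T) δ ≤ nc →
          C₁ * CliffordSensing.sampleBound N (k * T) ε δ ≤ ((nc * m : ℕ) : ℝ) →
          1 - δ ≤ S.prob (nc := nc) (m := m) fun C z =>
            IsUnit ((S.design C)ᵀ * S.design C).det ∧
            ∀ β t, S.SmallBias C β t →
              |S.estimator C z β t - S.γ β t| ≤ ε + S.bias C β t) ∧
        (∃ nc m : ℕ,
          C₁ * CliffordSensing.circuitBound N (k * T) δ ≤ nc ∧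
          C₁ * CliffordSensing.sampleBound N (k * T) ε δ ≤ ((nc * m : ℕ) : ℝ) ∧
          ((nc * m : ℕ) : ℝ) ≤ C₂ * CliffordSensing.sampleBound N (k * T) ε δ) ∧
        (2 * ε ^ 2 * Real.log (1 / δ) ≤ N →
          CliffordSensing.sampleBound N (k * T) ε δ = Real.log (((k * T : ℕ) : ℝ) / δ) / ε ^ 2) := by
  classical
  -- The summand 16 serves the Chernoff bound over circuits. The other serves the shots: with
  -- $\eta=a^2\epsilon/20$ one has $\eta^2/256=a^4\epsilon^2/102400$, and $409600=4\cdot102400$.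
  set c : ℝ := 16 + 409600 / a ^ 4 with hc
  have hc0 : 0 < c := by positivity
  have hc16 : 16 ≤ c := by rw [hc]; linarith [show 0 ≤ 409600 / a ^ 4 by positivity]
  have hca : 409600 ≤ c * a ^ 4 := by
    rw [hc, add_mul, div_mul_cancel₀ _ (by positivity)]
    linarith [show 0 ≤ 16 * a ^ 4 by positivity]
  refine ⟨c, 5 * c + 2, hc0, by positivity, ?_⟩
  intro N T kc k S ε δ hN hinj hne hγ hA hK2 hε hε1 hδ hδ1 hKδ
  have hK1 : 1 ≤ k * T := by
    rcases Nat.eq_zero_or_pos (k * T) with h | h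
    · rw [h, Nat.cast_zero] at hKδ; linarith
    · exact h
  refine ⟨?_, exists_circuits_shots hc0 hK1 hK2 hε hε1 hδ hδ1 hKδ,
    sampleBound_eq hN hK1 hε hε1 hδ hδ1 hKδ⟩
  intro nc m hnc hM
  have hcb := (circuitBound_pos_and_le hK1 hK2 hδ hδ1 hKδ).1
  have hL := log_two_le_log_div hδ hKδ
  have hlog2 : 0 < Real.log 2 := Real.log_pos (by norm_num)
  have hf := log_div_le_sampleBound (N := N) hε hε1 hδ hKδ
  have hncpos : 0 < nc := Nat.cast_pos (α := ℝ) |>.mp (lt_of_lt_of_le (mul_pos hc0 hcb) hnc)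
  have hMpos : 0 < nc * m := Nat.cast_pos (α := ℝ) |>.mp
    (lt_of_lt_of_le (mul_pos hc0 (by linarith)) hM)
  have hmpos : 0 < m := Nat.pos_of_mul_pos_left hMpos
  set η : ℝ := a ^ 2 * ε / 20 with hη
  have hη0 : 0 < η := by positivity
  have hexp : 4 * Real.log (((k * T : ℕ) : ℝ) / δ) ≤ (nc * m : ℕ) * η ^ 2 / 256 := by
    set L := Real.log (((k * T : ℕ) : ℝ) / δ) with hLdef
    have h1 : c * (L / ε ^ 2) ≤ (nc * m : ℕ) :=
      le_trans (mul_le_mul_of_nonneg_left (le_max_left _ _) hc0.le) hM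
    have hL0 : 0 ≤ L := by linarith
    calc 4 * L = 409600 * L / 102400 := by ring
      _ ≤ c * a ^ 4 * L / 102400 := by gcongr
      _ = c * (L / ε ^ 2) * η ^ 2 / 256 := by
          rw [hη]; field_simp; ring
      _ ≤ _ := by gcongr
  refine S.le_prob_of_forall hγ _ (fun C => ∃ b, 16 * S.isolatedCount C b < nc) hδ1.le
    (S.card_exists_isolatedCount_lt_le hN hinj hne hK2 hδ hδ1 hKδ
      (le_trans (mul_le_mul_of_nonneg_right hc16 hcb.le) hnc)) ?_
  intro C hC
  push Not at hC
  have hdet := S.isUnit_det_gram C fun b => by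
    have := hC b
    omega
  refine le_trans ?_ (le_trans (S.prob_exists_coeff_far_le (m := m) hγ C hC hη0 hncpos hmpos hdet)
    (exp_failure_le hK1 hδ hKδ hexp))
  refine Finset.sum_le_sum fun z _ => ?_
  have hw := shotProb_nonneg (fun n w => S.outcomeProb_nonneg hγ (C n) w) z
  by_cases hfar : ∃ b, η < |S.coeff C (empirical z) b - S.coeff C (S.exact C) b|
  -- Failure is compared outcome by outcome with some coefficient being far from its mean: if none
  -- is far, the desired event holds.
  · rw [if_pos hfar]
    split_ifs <;> first | exact hw | exact le_rfl
  · push Not at hfar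
    have hnn : 0 ≤ (if ∃ b, η < |S.coeff C (empirical z) b - S.coeff C (S.exact C) b|
        then shotProb (fun n => S.outcomeProb (C n)) z else 0) := by
      split_ifs <;> first | exact hw | exact le_rfl
    refine le_of_eq_of_le (if_neg (not_not.mpr ⟨hdet, ?_⟩)) hnn
    intro β t hsmall
    have hratio : |S.estimator C z β t - S.rate C (S.exact C) β t| ≤ ε :=
      abs_ratio_sub_le ha hA (S.fidelity_le hγ β t) (hγ β t).1 hε hε1 hsmall.1 hsmall.2
        (hfar _) (hfar _)
    calc _ ≤ |S.estimator C z β t - S.rate C (S.exact C) β t|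
          + |S.rate C (S.exact C) β t - S.γ β t| := abs_sub_le _ _ _
      _ ≤ _ := add_le_add hratio le_rfl
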